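/- Let $G^*$ be a DAG on $n$ vertices $V$. Two DAGs on $V$ are Markov equivalent if they represent the same conditional independence assertions (d-separations). The essential graph $Ess(G^*)$ is the mixed graph on $V$ whose directed edges are those that have the same direction in all DAGs Markov equivalent to $G^*$ and whose undirected edges are those whose direction differs in at least two of them. Let $\Delta$ be the maximum degree of $Ess(G^*)$ (edges of both kinds are counted), and let $H$ be its undirected subgraph. The sampler. For a connected undirected graph $G$ and a vertex $v$, $\mathrm{Flowed}(v,G)$ is the set of the edges of $G$ whose endpoints are not at equal distance from $v$, directed away from $v$. Let $G_v$ be $G$ without these edges and without the vertices that become isolated; then, recursively, $W(v,G)=\prod_{\hat G\in comp(G_v)}\sum_{u\in V(\hat G)}W(u,\hat G)$. $\mathrm{RandEdge}(G)$ draws $v^*\in V(G)$ with probability $W(v^*,G)/\sum_{v\in V(G)} W(v,G)$, directs the edges in $\mathrm{Flowed}(v^*,G)$ and continues recursively on each component of $G_{v^*}$. A random DAG is obtained from $Ess(G^*)$ by applying $\mathrm{RandEdge}$ to each component of $H$. The estimator (Subroutine 1). For $\mathcal I\subseteq V$ and a DAG $G'$ let $D(\mathcal I,G')$ be the number of edges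 of $H$ whose direction in $G'$ is obtained from the directed edges of $Ess(G^*)$ and the edges of $G'$ that meet $\mathcal I$ by applying the Meek rules until nothing changes. $\hat{\mathcal D}(\mathcal I)$ draws $N$ such random DAGs and returns the mean of $D(\mathcal I,\cdot)$ over them. The General Greedy algorithm. Given $Ess(G^*)$ (as lists of its undirected and of its directed edges), a budget $k$ and $N$, start with $\mathcal I_0=\emptyset$ and, for $i=1,\dots,k$, add to $\mathcal I_{i-1}$ a vertex $v\in V\setminus\mathcal I_{i-1}$ that maximizes $\hat{\mathcal D}(\mathcal I_{i-1}\cup\{v\})-\hat{\mathcal D}(\mathcal I_{i-1})$; return $\mathcal I_k$. Theorem. The computational complexity of the General Greedy algorithm with this estimator is $O(kNn^{\Delta+1})$. That is, on a random access machine with unit-cost arithmetic, unit-cost uniform random integers and memory initialized to zero, the algorithm can be executed so that, for some absolute constant $C$, for all $n$, all DAGs $G^*$ on $n$ vertices, all $1\le k\le n$ and all $N\ge 1$, and whatever the random choices are, it halts after at most $C\,k\,N\,n^{\Delta+1}$ steps. -/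

import Mathlib

namespace GreedyDesign

/-! ## Causal graphs, Markov equivalence, essential graphs -/

/-- A directed graph without directed cycles. -/
def IsDAG {n : ℕ} (G : Digraph (Fin n)) : Prop :=
  ∀ v, ¬ Relation.TransGen G.Adj v v

/-- The path `p` (a list of vertices) is active given `Z`: at every inner vertex `b`, between `a`
and `c` on the path, if `b` is a collider then `b` or one of its descendants lies in `Z`, and
otherwise `b` is not in `Z`. -/
def IsActive {n : ℕ} (G : Digraph (Fin n)) (Z : Set (Fin n)) (p : List (Fin n)) : Prop :=
  ∀ a b c, [a, b, c] <:+: p →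
    ((G.Adj a b ∧ G.Adj c b) → ∃ z ∈ Z, Relation.ReflTransGen G.Adj b z) ∧
    (¬ (G.Adj a b ∧ G.Adj c b) → b ∉ Z)

/-- `p` is a path from `x` to `y` in the skeleton of `G`. -/
def IsPath {n : ℕ} (G : Digraph (Fin n)) (x y : Fin n) (p : List (Fin n)) : Prop :=
  p.Nodup ∧ p.IsChain (fun a b => G.Adj a b ∨ G.Adj b a) ∧ p.head? = some x ∧ p.getLast? = some y

/-- The conditional independence assertion `X ⊥ Y | Z` is represented by `G` (d-separation). -/
def DSep {n : ℕ} (G : Digraph (Fin n)) (X Y Z : Set (Fin n)) : Prop :=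
  ∀ x ∈ X, ∀ y ∈ Y, ∀ p, IsPath G x y p → ¬ IsActive G Z p

/-- Two DAGs are Markov equivalent if they represent the same conditional independence
assertions. -/
def MarkovEquivalent {n : ℕ} (G₁ G₂ : Digraph (Fin n)) : Prop :=
  ∀ X Y Z : Set (Fin n), Disjoint X Y → Disjoint X Z → Disjoint Y Z →
    (DSep G₁ X Y Z ↔ DSep G₂ X Y Z)

/-- The Markov equivalence class of `G`. -/
def markovClass {n : ℕ} (G : Digraph (Fin n)) : Set (Digraph (Fin n)) :=
  {G' | IsDAG G' ∧ MarkovEquivalent G G'}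

/-- A mixed graph on the vertices `0, …, n - 1`. -/
structure MixedGraph (n : ℕ) where
  /-- `und u v`: there is an undirected edge between `u` and `v`. -/
  und : Fin n → Fin n → Prop
  /-- `dir u v`: there is a directed edge from `u` to `v`. -/
  dir : Fin n → Fin n → Prop
  und_symm : ∀ u v, und u v → und v u

/-- The essential graph: an edge is directed if it has that direction in all members of the Markov
equivalence class, and undirected if its direction differs in two members. -/
def essentialGraph {n : ℕ} (G : Digraph (Fin n)) : MixedGraph n where
  und u v := (∃ G₁ ∈ markovClass G, G₁.Adj u v) ∧ (∃ G₂ ∈ markovClass G, G₂.Adj v u)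
  dir u v := ∀ G' ∈ markovClass G, G'.Adj u v
  und_symm _ _ h := ⟨h.2, h.1⟩

open Classical in
/-- The number of vertices joined to `v` by an edge of either kind. -/
noncomputable def MixedGraph.degree {n : ℕ} (M : MixedGraph n) (v : Fin n) : ℕ :=
  (Finset.univ.filter fun w => M.und v w ∨ M.dir v w ∨ M.dir w v).card

/-- The maximum degree of a mixed graph. -/
noncomputable def MixedGraph.maxDegree {n : ℕ} (M : MixedGraph n) : ℕ :=
  Finset.univ.sup M.degree

/-- A mixed graph `(V, E, A)` as an input of an algorithm: the list of its undirected edges (each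
of them listed once) and the list of its directed edges. -/
structure EdgeLists (n : ℕ) where
  und : List (Fin n × Fin n)
  dir : List (Fin n × Fin n)

open Classical in
/-- The edge lists of a mixed graph. -/
noncomputable def MixedGraph.edgeLists {n : ℕ} (M : MixedGraph n) : EdgeLists n where
  und := ((List.finRange n).product (List.finRange n)).filter fun e =>
    decide (e.1 < e.2 ∧ M.und e.1 e.2)
  dir := ((List.finRange n).product (List.finRange n)).filter fun e => decide (M.dir e.1 e.2)

/-! ## Randomized computations with a step count

The machine is a random access machine with unit-cost arithmetic and unit-cost random integers,
whose memory cells are initially zero, so that a fresh array (a constant function below) is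
available in one step. An array is a function on its index set, and a write to one of its cells is
a `Function.update`. Lists are linked lists. -/

/-- A randomized computation: the joint law of its result and of the number of steps it takes.
The outcome `none` stands for a run that gets stuck or does not halt. -/
def Comp (α : Type) : Type := PMF (Option (α × ℕ))

/-- Sequential composition: the step counts add up. -/
noncomputable def Comp.andThen {α β : Type} (m : Comp α) (f : α → Comp β) : Comp β :=
  PMF.bind m fun r => match r with
    | none => PMF.pure none
    | some (a, t) => PMF.map (Option.map fun bs => (bs.1, t + bs.2)) (f a)

noncomputable instance : Monad Comp where
  pure a := PMF.pure (some (a, 0))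
  bind := Comp.andThen

/-- Compute `a` by a bounded number of elementary machine operations (reading or writing an array
cell, arithmetic, comparison, Boolean operations, adding an element to a linked list, access to a
fresh array): one step. -/
noncomputable def op {α : Type} (a : α) : Comp α := PMF.pure (some (a, 1))

/-- A run without result. -/
noncomputable def stuck {α : Type} : Comp α := PMF.pure none

/-- A uniformly distributed random integer in `{0, …, m - 1}`: one step. -/
noncomputable def randBelow (m : ℕ) : Comp ℕ :=
  if h : m = 0 then stuck
  else
    haveI : NeZero m := ⟨h⟩
    PMF.map (fun r : Fin m => some (r.val, 1)) (PMF.uniformOfFintype (Fin m))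

/-- `m` always halts with a result, after at most `T` steps, whatever the random choices are. -/
def Comp.RunsInTime {α : Type} (m : Comp α) (T : ℕ) : Prop :=
  ∀ r ∈ PMF.support m, ∃ a t, r = some (a, t) ∧ t ≤ T

/-- The loop `for a in l`, acting on a state; one step per iteration besides the body. -/
noncomputable def forEach {α σ : Type} (l : List α) (s : σ) (body : α → σ → Comp σ) : Comp σ :=
  match l with
  | [] => op s
  | a :: l => do
    let s₁ ← op s
    let s₂ ← body a s₁
    forEach l s₂ body

/-- The loop `for i = 1 to k`, acting on a state; one step per iteration besides the body. -/
noncomputable def loop {σ : Type} (k : ℕ) (s : σ) (body : σ → Comp σ) : Comp σ :=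
  match k with
  | 0 => op s
  | k + 1 => do
    let s₁ ← op s
    let s₂ ← body s₁
    loop k s₂ body

/-- Does some element of the list pass the test? -/
noncomputable def anyOf {α : Type} (l : List α) (test : α → Comp Bool) : Comp Bool :=
  forEach l false fun a b => do
    let c ← test a
    op (b || c)

/-! ## Graph routines

Inside the algorithm an undirected graph without isolated vertices is the list of its edges, each
of them listed once. -/

/-- Write one entry of a two-dimensional array. -/
def set2 {n : ℕ} {α : Type} (f : Fin n → Fin n → α) (u v : Fin n) (x : α) : Fin n → Fin n → α :=
  Function.update f u (Function.update (f u) v x)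

/-- Add `x` to the list stored in cell `u`. -/
def pushAt {n : ℕ} {α : Type} (f : Fin n → List α) (u : Fin n) (x : α) : Fin n → List α :=
  Function.update f u (x :: f u)

/-- The adjacency lists of the graph with edge list `E`, added to given ones. -/
noncomputable def adjLists {n : ℕ} (E : List (Fin n × Fin n)) (nbr : Fin n → List (Fin n)) :
    Comp (Fin n → List (Fin n)) :=
  forEach E nbr fun e nbr => do
    let nbr₁ ← op (pushAt nbr e.1 e.2)
    op (pushAt nbr₁ e.2 e.1)

/-- The list of the vertices, without repetition, of the graph with edge list `E`. -/
noncomputable def vertexList {n : ℕ} (E : List (Fin n × Fin n)) : Comp (List (Fin n)) := do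
  let seen ← op fun _ : Fin n => false
  let s ← forEach E (([] : List (Fin n)), seen) fun e s =>
    forEach [e.1, e.2] s fun u s => do
      let old ← op (s.2 u)
      if old then pure s else op (u :: s.1, Function.update s.2 u true)
  pure s.1

/-- Breadth-first search, layer by layer. `lab w = some (r, d)` records that `w` was reached from
the root `r` at distance `d`; the current layer is at distance `d`. The search ends at an empty
layer; the first argument bounds the number of layers. -/
noncomputable def bfsLayers {n : ℕ} (nbr : Fin n → List (Fin n)) (root : Fin n) :
    ℕ → ℕ → List (Fin n) → (Fin n → Option (Fin n × ℕ)) → Comp (Fin n → Option (Fin n × ℕ))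
  | 0, _, _, lab => op lab
  | _ + 1, _, [], lab => op lab
  | b + 1, d, u :: us, lab => do
    let s ← forEach (u :: us) (([] : List (Fin n)), lab) fun u s =>
      forEach (nbr u) s fun w s => do
        let seen ← op (s.2 w).isSome
        if seen then pure s else op (w :: s.1, Function.update s.2 w (some (root, d + 1)))
    bfsLayers nbr root b (d + 1) s.1 s.2

/-- Breadth-first search from `root` in the graph with edge list `E` and adjacency lists `nbr`.
A connected component has at most `E.length + 1` vertices, hence at most as many layers. -/
noncomputable def bfs {n : ℕ} (E : List (Fin n × Fin n)) (nbr : Fin n → List (Fin n))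
    (root : Fin n) (lab : Fin n → Option (Fin n × ℕ)) : Comp (Fin n → Option (Fin n × ℕ)) := do
  let lab₁ ← op (Function.update lab root (some (root, 0)))
  bfsLayers nbr root (E.length + 1) 0 [root] lab₁

/-- The connected components (as edge lists) of the graph with edge list `E`. -/
noncomputable def components {n : ℕ} (E : List (Fin n × Fin n)) :
    Comp (List (List (Fin n × Fin n))) := do
  let empty ← op fun _ : Fin n => ([] : List (Fin n))
  let nbr ← adjLists E empty
  let unlabelled ← op fun _ : Fin n => (none : Option (Fin n × ℕ))
  let s ← forEach E (([] : List (Fin n)), unlabelled) fun e s => do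
    let seen ← op (s.2 e.1).isSome
    if seen then pure s
    else do
      let lab ← bfs E nbr e.1 s.2
      op (e.1 :: s.1, lab)
  let noEdges ← op fun _ : Fin n => ([] : List (Fin n × Fin n))
  let bucket ← forEach E noEdges fun e bucket =>
    match s.2 e.1 with
    | some (r, _) => op (pushAt bucket r e)
    | none => stuck
  forEach s.1 [] fun r cs => op (bucket r :: cs)

/-! ## The sampler -/

/-- The function `Flowed` for the source `v` in the connected graph with edge list `E`: the list of
the edges whose endpoints are not at equal distance from `v`, directed away from `v`; and the list
of the remaining edges, which is the graph without the edges of the first list. -/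
noncomputable def flowed {n : ℕ} (E : List (Fin n × Fin n)) (v : Fin n) :
    Comp (List (Fin n × Fin n) × List (Fin n × Fin n)) := do
  let empty ← op fun _ : Fin n => ([] : List (Fin n))
  let nbr ← adjLists E empty
  let unlabelled ← op fun _ : Fin n => (none : Option (Fin n × ℕ))
  let lab ← bfs E nbr v unlabelled
  forEach E ([], []) fun e s =>
    match lab e.1, lab e.2 with
    | some (_, d₁), some (_, d₂) =>
      if d₁ < d₂ then op ((e.1, e.2) :: s.1, s.2)
      else if d₂ < d₁ then op ((e.2, e.1) :: s.1, s.2)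
      else op (s.1, e :: s.2)
    | _, _ => stuck

/-- The recursive function `W` for the source `v` in the connected graph with edge list `E`. The
first argument bounds the depth of the recursion; a run that exceeds the bound is stuck. -/
noncomputable def W {n : ℕ} : ℕ → List (Fin n × Fin n) → Fin n → Comp ℕ
  | 0, _, _ => stuck
  | depth + 1, E, v => do
    let F ← flowed E v
    let cs ← components F.2
    forEach cs 1 fun C p => do
      let vs ← vertexList C
      let s ← forEach vs 0 fun u s => do
        let w ← W depth C u
        op (s + w)
      op (p * s)

/-- Walk along a list of weighted vertices to the vertex to which the number `r` belongs. -/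
noncomputable def locate {n : ℕ} : List (Fin n × ℕ) → ℕ → Comp (Fin n)
  | [], _ => stuck
  | (v, w) :: l, r => do
    let here ← op (decide (r < w))
    if here then pure v
    else do
      let r₁ ← op (r - w)
      locate l r₁

/-- A random vertex `v` of the connected graph with edge list `E`, with probability proportional
to `W v`. -/
noncomputable def randomSource {n : ℕ} (depth : ℕ) (E : List (Fin n × Fin n)) : Comp (Fin n) := do
  let vs ← vertexList E
  let ws ← forEach vs (([] : List (Fin n × ℕ)), 0) fun v s => do
    let w ← W depth E v
    op ((v, w) :: s.1, s.2 + w)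
  let r ← randBelow ws.2
  locate ws.1 r

/-- The recursive function `RandEdge` for the connected graph with edge list `E`: the directed
edges that it chooses are added to the list `A`. The first argument bounds the depth of the
recursion; a run that exceeds the bound is stuck. -/
noncomputable def randEdge {n : ℕ} :
    ℕ → List (Fin n × Fin n) → List (Fin n × Fin n) → Comp (List (Fin n × Fin n))
  | 0, _, _ => stuck
  | depth + 1, E, A => do
    let v ← randomSource (depth + 1) E
    let F ← flowed E v
    let A₁ ← forEach F.1 A fun e A => op (e :: A)
    let cs ← components F.2
    forEach cs A₁ fun C A => randEdge depth C A

/-- One random member of the Markov equivalence class, as the list of its directed edges. In the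
recursive calls every graph has fewer edges than the one before, which bounds the depth. -/
noncomputable def sampleDAG {n : ℕ} (M : EdgeLists n) : Comp (List (Fin n × Fin n)) := do
  let A ← forEach M.dir [] fun e A => op (e :: A)
  let cs ← components M.und
  forEach cs A fun C A => randEdge M.und.length C A

/-! ## The number of edges resolved by an intervention -/

/-- Neither direction of the edge between `a` and `b` is known. -/
def unknown {n : ℕ} (known : Fin n → Fin n → Bool) (a b : Fin n) : Bool :=
  !known a b && !known b a

/-- Does one of the four Meek rules turn the edge `a - b` of unknown direction into `a → b`?
1. `c → a` with `c`, `b` not adjacent.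
2. `a → c → b`.
3. `a - c → b` and `a - d → b` with `c`, `d` not adjacent.
4. `a - d → c → b` with `d`, `b` not adjacent and `a`, `c` adjacent. -/
noncomputable def meekForces {n : ℕ} (adj : Fin n → Fin n → Bool) (nbr : Fin n → List (Fin n))
    (known : Fin n → Fin n → Bool) (a b : Fin n) : Comp Bool := do
  let r₁ ← anyOf (nbr a) fun c => op (decide (c ≠ b) && known c a && !adj c b)
  let r₂ ← anyOf (nbr a) fun c => op (known a c && known c b)
  let r₃ ← anyOf (nbr a) fun c => anyOf (nbr a) fun d =>
    op (decide (c ≠ d) && unknown known a c && unknown known a d && known c b && known d b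
      && !adj c d)
  let r₄ ← anyOf (nbr a) fun d => anyOf (nbr a) fun c =>
    op (decide (d ≠ b) && unknown known a d && known d c && known c b && !adj d b)
  op (r₁ || r₂ || r₃ || r₄)

/-- Apply the Meek rules to all edges of the list `E`, again and again, until nothing changes.
Every round but the last settles an edge, so that `E.length` rounds are enough; the first argument
bounds the number of rounds. -/
noncomputable def meekRounds {n : ℕ} (adj : Fin n → Fin n → Bool) (nbr : Fin n → List (Fin n))
    (E : List (Fin n × Fin n)) :
    ℕ → (Fin n → Fin n → Bool) → Comp (Fin n → Fin n → Bool)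
  | 0, known => op known
  | b + 1, known => do
    let s ← forEach E (known, false) fun e s => do
      let isOpen ← op (unknown s.1 e.1 e.2)
      if isOpen then do
        let forth ← meekForces adj nbr s.1 e.1 e.2
        if forth then op (set2 s.1 e.1 e.2 true, true)
        else do
          let back ← meekForces adj nbr s.1 e.2 e.1
          if back then op (set2 s.1 e.2 e.1 true, true) else pure s
      else pure s
    if s.2 then meekRounds adj nbr E b s.1 else op s.1

/-- `D(I, G)`: the number of undirected edges of the essential graph `M` whose directions in the
DAG with edge list `G` are learned by intervening on the vertices of `I`, that is, by applying the
Meek rules to the directed edges of `M` and the edges of `G` that meet `I`. -/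
noncomputable def resolvedCount {n : ℕ} (M : EdgeLists n) (I : Fin n → Bool)
    (G : List (Fin n × Fin n)) : Comp ℕ := do
  let empty ← op fun _ : Fin n => ([] : List (Fin n))
  let nbr₁ ← adjLists M.und empty
  let nbr ← adjLists M.dir nbr₁
  let noAdj ← op fun _ _ : Fin n => false
  let adj₁ ← forEach M.und noAdj fun e adj => op (set2 (set2 adj e.1 e.2 true) e.2 e.1 true)
  let adj ← forEach M.dir adj₁ fun e adj => op (set2 (set2 adj e.1 e.2 true) e.2 e.1 true)
  let nothing ← op fun _ _ : Fin n => false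
  let known₁ ← forEach M.dir nothing fun e known => op (set2 known e.1 e.2 true)
  let known₂ ← forEach G known₁ fun e known =>
    if I e.1 || I e.2 then op (set2 known e.1 e.2 true) else op known
  let known ← meekRounds adj nbr M.und M.und.length known₂
  forEach M.und 0 fun e c => if unknown known e.1 e.2 then op c else op (c + 1)

/-! ## The estimator and the greedy algorithm -/

/-- The unbiased estimator: draw `N` DAGs from the Markov equivalence class and return the mean
of `D(I, ·)` over them. -/
noncomputable def estimate {n : ℕ} (M : EdgeLists n) (I : Fin n → Bool) (N : ℕ) : Comp ℚ := do
  let Gs ← loop N ([] : List (List (Fin n × Fin n))) fun Gs => do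
    let G ← sampleDAG M
    op (G :: Gs)
  let s ← forEach Gs ((0 : ℕ), (0 : ℕ)) fun G s => do
    let d ← resolvedCount M I G
    op (s.1 + d, s.2 + 1)
  op ((s.1 : ℚ) / (s.2 : ℚ))

/-- A vertex outside `I` with the largest estimated marginal gain (with its gain); there is none
if `I` contains all vertices. -/
noncomputable def bestVertex {n : ℕ} (M : EdgeLists n) (N : ℕ) (I : Fin n → Bool) :
    Comp (Option (Fin n × ℚ)) :=
  forEach (List.finRange n) none fun v best => do
    let chosen ← op (I v)
    if chosen then pure best
    else do
      let Iv ← op (Function.update I v true)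
      let x ← estimate M Iv N
      let y ← estimate M I N
      match best with
      | none => op (some (v, x - y))
      | some (u, g) => if g < x - y then op (some (v, x - y)) else op (some (u, g))

/-- The General Greedy algorithm, run on the essential graph with budget `k` and with `N` samples
for each evaluation of the estimator. The result is the intervention target set. -/
noncomputable def generalGreedy {n : ℕ} (M : EdgeLists n) (k N : ℕ) : Comp (Fin n → Bool) := do
  let I₀ ← op fun _ : Fin n => false
  loop k I₀ fun I => do
    let best ← bestVertex M N I
    match best with
    | none => stuck
    | some (v, _) => op (Function.update I v true)

end GreedyDesign

/-!
The step count of the greedy algorithm is `k * n * 2 * N` times the cost of one sample and of one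
evaluation of `D(I, ·)`, so that it suffices to do both in `O(n ^ Δ)` steps, with a constant that
does not depend on `Δ`.

*The sampler.* Breadth-first search, and with it `flowed` and `components`, takes linear time
(`ensures_bfs`, `ensures_components`, `ensures_flowed`): the total length of the adjacency lists of
the unlabelled vertices is a potential that pays for the steps. In a connected graph every vertex
other than the source `v` has a neighbour nearer to `v`, and the edge between them is directed by
`flowed`. Hence the maximum degree drops with each level of the recursion, and `v` disappears. If a
part with `p` vertices and degrees at most `δ` costs `T δ p` for each call of `W`, then
`T δ p ≤ c * δ * p + ∑ q * T (δ - 1) q`, where the sum runs over the numbers `q` of vertices of the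
components of the rest, and these add up to at most `p - 1`. This gives
`T δ p = O(p ^ (δ - 1))` for `δ ≥ 1`; the gap between `(p - 1) ^ (δ - 1)` and `p ^ (δ - 1)` absorbs
the linear term, which makes the constant absolute (`IsResidue.sum_weightSteps_le`). A random source
needs `W` for all `p` vertices, hence `O(p ^ δ)` steps, and the recursion of `randEdge` is
dominated by its first level (`ensures_randEdge`). Chordality of the components is not needed.

*The Meek rules.* With `u ≤ n * Δ` undirected edges there are at most `u` rounds of `u` tests, each
of `O(Δ ^ 2)` steps. Since `Δ < n`, this is `O(n ^ 2 * Δ ^ 4) = O(n ^ Δ)` if `Δ ≥ 2`. If `Δ ≤ 1`, no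
rule ever applies, and the only round takes `O(n)` steps (`ensures_meekRounds`).

No run gets stuck: every vertex of a connected part is reached by the search, since labels are at
most the number of edges (`Extends.dist_le`); the number of edges decreases in the recursive calls;
all weights are positive; and while fewer than `n` vertices are chosen, there is a best one.
-/

namespace GreedyDesign

variable {n : ℕ}

/-! ### Reasoning about the step count of a randomized computation -/

/-- Whatever the random choices are, `m` halts with a result `a` after `t` steps such that
`Q a t`. The postcondition sees the result and the step count together, which is what an amortized
analysis needs. -/
def Comp.Ensures {α : Type} (m : Comp α) (Q : α → ℕ → Prop) : Prop :=
  ∀ r ∈ PMF.support m, ∃ a t, r = some (a, t) ∧ Q a t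

theorem Comp.Ensures.mono {α : Type} {m : Comp α} {Q R : α → ℕ → Prop} (h : m.Ensures Q)
    (hQR : ∀ a t, Q a t → R a t) : m.Ensures R := fun r hr => by
  obtain ⟨a, t, rfl, hq⟩ := h r hr
  exact ⟨a, t, rfl, hQR a t hq⟩

theorem ensures_pure {α : Type} {a : α} {Q : α → ℕ → Prop} (h : Q a 0) :
    (pure a : Comp α).Ensures Q := fun r hr => by
  have hr' : r = some (a, 0) := by
    simpa using (PMF.mem_support_pure_iff (some (a, 0)) r).1 hr
  exact ⟨a, 0, hr', h⟩

theorem ensures_op {α : Type} {a : α} {Q : α → ℕ → Prop} (h : Q a 1) :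
    (op a).Ensures Q := fun r hr => by
  have hr' : r = some (a, 1) := by
    simpa using (PMF.mem_support_pure_iff (some (a, 1)) r).1 hr
  exact ⟨a, 1, hr', h⟩

theorem Comp.Ensures.bind {α β : Type} {m : Comp α} {f : α → Comp β} {Q : α → ℕ → Prop}
    {R : β → ℕ → Prop} (hm : m.Ensures Q)
    (hf : ∀ a t, Q a t → (f a).Ensures fun b t' => R b (t + t')) : (m >>= f).Ensures R := by
  intro r hr
  obtain ⟨q, hq, hr⟩ := (PMF.mem_support_bind_iff m _ r).1 hr
  obtain ⟨a, t, rfl, hat⟩ := hm q hq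
  obtain ⟨s, hs, rfl⟩ := (PMF.mem_support_map_iff _ _ r).1 hr
  obtain ⟨b, t', rfl, hb⟩ := hf a t hat s hs
  exact ⟨b, t + t', rfl, hb⟩

theorem ensures_op_bind {α β : Type} {a : α} {f : α → Comp β} {R : β → ℕ → Prop}
    (hf : (f a).Ensures fun b t => R b (1 + t)) : (op a >>= f).Ensures R :=
  (ensures_op (Q := fun a' t => a' = a ∧ t = 1) ⟨rfl, rfl⟩).bind <| by
    rintro _ _ ⟨rfl, rfl⟩
    exact hf

theorem ensures_randBelow {m : ℕ} (hm : 0 < m) {Q : ℕ → ℕ → Prop} (h : ∀ r < m, Q r 1) :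
    (randBelow m).Ensures Q := by
  intro r hr
  have hm' : m ≠ 0 := hm.ne'
  have : NeZero m := ⟨hm'⟩
  have heq : randBelow m
      = PMF.map (fun r : Fin m => some (r.val, 1)) (PMF.uniformOfFintype (Fin m)) := dif_neg hm'
  rw [heq] at hr
  obtain ⟨i, -, rfl⟩ := (PMF.mem_support_map_iff _ _ r).1 hr
  exact ⟨i.val, 1, rfl, h _ i.isLt⟩

/-- The loop rule. The invariant speaks about the elements of the list that are still to come, the
state, and the number of steps so far. -/
theorem ensures_forEach {α σ : Type} {body : α → σ → Comp σ} {Inv : List α → σ → ℕ → Prop}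
    (hbody : ∀ a l s t, Inv (a :: l) s t →
      (body a s).Ensures fun s' t' => Inv l s' (t + 1 + t')) :
    ∀ (l : List α) (s : σ) (t : ℕ), Inv l s t →
      (forEach l s body).Ensures fun s' t' => ∃ u, t' = u + 1 ∧ Inv [] s' (t + u)
  | [], s, t, h => ensures_op ⟨0, rfl, h⟩
  | a :: l, s, t, h => by
    refine ensures_op_bind ((hbody a l s t h).bind fun s' t' h' => ?_)
    refine (ensures_forEach hbody l s' (t + 1 + t') h').mono ?_
    rintro s'' _ ⟨u, rfl, hu⟩
    exact ⟨1 + t' + u, by omega, by convert hu using 1; omega⟩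

/-- The loop rule for an invariant `P` of the remaining elements and the state, if the iteration
for `a` takes at most `g a` steps. -/
theorem ensures_forEach_sum {α σ : Type} {body : α → σ → Comp σ} {l : List α} {s : σ}
    (P : List α → σ → Prop) (g : α → ℕ)
    (hbody : ∀ a r s, a ∈ l → P (a :: r) s → (body a s).Ensures fun s' t => P r s' ∧ t ≤ g a)
    (hs : P l s) :
    (forEach l s body).Ensures fun s' t => P [] s' ∧ t ≤ (l.map fun a => g a + 1).sum + 1 := by
  have key := ensures_forEach (body := body)
    (Inv := fun r s' t => (∀ a ∈ r, a ∈ l) ∧ P r s' ∧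
      t + (r.map fun a => g a + 1).sum ≤ (l.map fun a => g a + 1).sum)
    (fun a r s' t h => by
      obtain ⟨hr, hP, ht⟩ := h
      refine (hbody a r s' (hr a (by simp)) hP).mono fun s'' t' h =>
        ⟨fun b hb => hr b (by simp [hb]), h.1, ?_⟩
      have := h.2
      simp only [List.map_cons, List.sum_cons] at ht
      omega) l s 0 ⟨fun a ha => ha, hs, by simp⟩
  refine key.mono ?_
  rintro s' _ ⟨u, rfl, -, hP, hu⟩
  refine ⟨hP, ?_⟩
  simp only [List.map_nil, List.sum_nil] at hu
  omega

theorem ensures_forEach_const {α σ : Type} {body : α → σ → Comp σ} {l : List α} {s : σ}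
    (P : List α → σ → Prop) (c : ℕ)
    (hbody : ∀ a r s, a ∈ l → P (a :: r) s → (body a s).Ensures fun s' t => P r s' ∧ t ≤ c)
    (hs : P l s) :
    (forEach l s body).Ensures fun s' t => P [] s' ∧ t ≤ l.length * (c + 1) + 1 := by
  simpa using ensures_forEach_sum P (fun _ => c) hbody hs

/-- A loop whose body is deterministic computes a fold. -/
theorem ensures_forEach_foldl {α σ : Type} {body : α → σ → Comp σ} (f : σ → α → σ) (c : ℕ) :
    ∀ (l : List α) (s : σ),
      (∀ a ∈ l, ∀ s, (body a s).Ensures fun s' t => s' = f s a ∧ t ≤ c) →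
      (forEach l s body).Ensures fun s' t => s' = l.foldl f s ∧ t ≤ l.length * (c + 1) + 1
  | [], _, _ => ensures_op ⟨rfl, by simp⟩
  | a :: l, s, h => by
    refine ensures_op_bind ((h a (by simp) s).bind ?_)
    rintro _ t ⟨rfl, ht⟩
    refine (ensures_forEach_foldl f c l (f s a) fun b hb => h b (by simp [hb])).mono ?_
    rintro _ t' ⟨rfl, ht'⟩
    refine ⟨rfl, ?_⟩
    rw [List.length_cons, add_mul]
    omega

/-- The rule for counting loops. The invariant speaks about the number of iterations still to
come. -/
theorem ensures_loop {σ : Type} {body : σ → Comp σ} (P : ℕ → σ → Prop) (c : ℕ) :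
    ∀ (k : ℕ) (s : σ),
      (∀ j s, j < k → P (j + 1) s → (body s).Ensures fun s' t => P j s' ∧ t ≤ c) → P k s →
      (loop k s body).Ensures fun s' t => P 0 s' ∧ t ≤ k * (c + 1) + 1
  | 0, _, _, hs => ensures_op ⟨hs, by simp⟩
  | k + 1, s, h, hs => by
    refine ensures_op_bind ((h k s (by omega) hs).bind ?_)
    rintro s' t ⟨hs', ht⟩
    refine (ensures_loop P c k s' (fun j s hj => h j s (by omega)) hs').mono ?_
    rintro s'' t' ⟨hs'', ht'⟩
    refine ⟨hs'', ?_⟩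
    rw [add_mul]
    omega

theorem Comp.Ensures.runsInTime {α : Type} {m : Comp α} {Q : α → ℕ → Prop} {T : ℕ}
    (h : m.Ensures Q) (hQ : ∀ a t, Q a t → t ≤ T) : m.RunsInTime T := fun r hr => by
  obtain ⟨a, t, rfl, hq⟩ := h r hr
  exact ⟨a, t, rfl, hQ a t hq⟩

/-! ### Graphs as edge lists -/

/-- The vertices `x` and `y` are the ends of an edge of the list `E`. -/
def Joined (E : List (Fin n × Fin n)) (x y : Fin n) : Prop := (x, y) ∈ E ∨ (y, x) ∈ E

/-- The degree of `x` in the graph with edge list `E`, with multiplicities if an edge is listed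
more than once. -/
def deg (E : List (Fin n × Fin n)) (x : Fin n) : ℕ :=
  E.countP (fun e => e.1 = x) + E.countP (fun e => e.2 = x)

/-- The vertices of the graph with edge list `E`. -/
def verts (E : List (Fin n × Fin n)) : Finset (Fin n) := (E.map Prod.fst ++ E.map Prod.snd).toFinset

/-- The graph with edge list `E` is connected: a set of vertices that every edge either lies in or
avoids contains all edges as soon as it contains one. -/
def Conn (E : List (Fin n × Fin n)) : Prop :=
  ∀ S : Fin n → Prop, (∀ e ∈ E, S e.1 ↔ S e.2) → ∀ e ∈ E, S e.1 → ∀ e' ∈ E, S e'.1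

theorem Joined.symm {E : List (Fin n × Fin n)} {x y : Fin n} (h : Joined E x y) : Joined E y x :=
  Or.symm h

theorem mem_verts {E : List (Fin n × Fin n)} {x : Fin n} :
    x ∈ verts E ↔ ∃ e ∈ E, e.1 = x ∨ e.2 = x := by
  simp only [verts, List.mem_toFinset, List.mem_append, List.mem_map]
  constructor
  · rintro (⟨e, he, rfl⟩ | ⟨e, he, rfl⟩)
    exacts [⟨e, he, .inl rfl⟩, ⟨e, he, .inr rfl⟩]
  · rintro ⟨e, he, h | h⟩
    exacts [.inl ⟨e, he, h⟩, .inr ⟨e, he, h⟩]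

theorem deg_cons (e : Fin n × Fin n) (E : List (Fin n × Fin n)) (x : Fin n) :
    deg (e :: E) x = deg E x + ((if e.1 = x then 1 else 0) + if e.2 = x then 1 else 0) := by
  simp only [deg, List.countP_cons, decide_eq_true_eq]
  omega

theorem sum_deg (E : List (Fin n × Fin n)) : ∑ x, deg E x = 2 * E.length := by
  induction E with
  | nil => simp [deg]
  | cons e E ih =>
    simp only [deg_cons, Finset.sum_add_distrib, ih, Finset.sum_ite_eq, Finset.mem_univ, if_true,
      List.length_cons]
    omega

theorem deg_pos_iff {E : List (Fin n × Fin n)} {x : Fin n} : 0 < deg E x ↔ x ∈ verts E := by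
  rw [mem_verts, deg, Nat.add_pos_iff_pos_or_pos, List.countP_pos_iff, List.countP_pos_iff]
  simp only [decide_eq_true_eq]
  constructor
  · rintro (⟨e, he, h⟩ | ⟨e, he, h⟩)
    exacts [⟨e, he, .inl h⟩, ⟨e, he, .inr h⟩]
  · rintro ⟨e, he, h | h⟩
    exacts [.inl ⟨e, he, h⟩, .inr ⟨e, he, h⟩]

theorem two_mul_length_le {E : List (Fin n × Fin n)} {δ : ℕ} (h : ∀ x, deg E x ≤ δ) :
    2 * E.length ≤ δ * (verts E).card := by
  rw [← sum_deg, ← Finset.sum_subset (Finset.subset_univ (verts E))]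
  · calc ∑ x ∈ verts E, deg E x ≤ ∑ _x ∈ verts E, δ := Finset.sum_le_sum fun x _ => h x
      _ = δ * (verts E).card := by rw [Finset.sum_const, smul_eq_mul, mul_comm]
  · intro x _ hx
    have := mt deg_pos_iff.1 hx
    omega

theorem card_verts_le (E : List (Fin n × Fin n)) : (verts E).card ≤ 2 * E.length := by
  refine (List.toFinset_card_le _).trans ?_
  simp only [List.length_append, List.length_map]
  omega

theorem two_le_card_verts {E : List (Fin n × Fin n)} (hne : E ≠ []) (hE : ∀ e ∈ E, e.1 ≠ e.2) :
    2 ≤ (verts E).card := by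
  obtain ⟨e, he⟩ := List.exists_mem_of_ne_nil E hne
  rw [← Finset.card_pair (hE e he)]
  refine Finset.card_le_card fun x hx => mem_verts.2 ⟨e, he, ?_⟩
  simp only [Finset.mem_insert, Finset.mem_singleton] at hx
  exact hx.imp Eq.symm Eq.symm

theorem deg_le_of_subperm {C E : List (Fin n × Fin n)} (h : C.Subperm E) (x : Fin n) :
    deg C x ≤ deg E x :=
  Nat.add_le_add (h.countP_le _) (h.countP_le _)

theorem verts_mono {C E : List (Fin n × Fin n)} (h : C ⊆ E) : verts C ⊆ verts E := fun x hx => by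
  obtain ⟨e, he, hx⟩ := mem_verts.1 hx
  exact mem_verts.2 ⟨e, h he, hx⟩

/-- A connected graph in which all degrees are at most one is a single edge. -/
theorem Conn.length_le_one {E : List (Fin n × Fin n)} (hE : Conn E) (h : ∀ x, deg E x ≤ 1) :
    E.length ≤ 1 := by
  match E with
  | [] => simp
  | [e] => simp
  | e :: e' :: E =>
    exfalso
    have h₁ := h e'.1
    have h₂ : e'.1 = e.1 ∨ e'.1 = e.2 := by
      refine hE (fun x => x = e.1 ∨ x = e.2) (fun f hf => ?_) e (by simp) (.inl rfl) e' (by simp)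
      rcases List.mem_cons.1 hf with rfl | hf
      · simp
      · have hdeg : ∀ x, f.1 = x ∨ f.2 = x → 0 < deg (e' :: E) x := fun x hx =>
          deg_pos_iff.2 (mem_verts.2 ⟨f, hf, hx⟩)
        have haux : ∀ x, f.1 = x ∨ f.2 = x → ¬ (x = e.1 ∨ x = e.2) := by
          intro x hx hxe
          have h₃ := hdeg x hx
          have h₄ := h x
          rw [deg_cons] at h₄
          rcases hxe with rfl | rfl
          · rw [if_pos rfl] at h₄
            omega
          · rw [if_pos (rfl : e.2 = e.2)] at h₄
            omega
        exact iff_of_false (haux _ (.inl rfl)) (haux _ (.inr rfl))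
    rw [deg_cons, deg_cons, if_pos (rfl : e'.1 = e'.1)] at h₁
    rcases h₂ with h₂ | h₂
    · rw [if_pos h₂.symm] at h₁
      omega
    · rw [if_pos h₂.symm] at h₁
      omega

theorem ensures_adjLists (E : List (Fin n × Fin n)) (nbr : Fin n → List (Fin n)) :
    (adjLists E nbr).Ensures fun nbr' t => t ≤ 3 * E.length + 1 ∧
      (∀ x y, y ∈ nbr' x ↔ y ∈ nbr x ∨ Joined E x y) ∧
      ∀ x, (nbr' x).length = (nbr x).length + deg E x := by
  refine (ensures_forEach_foldl (fun nbr e => pushAt (pushAt nbr e.1 e.2) e.2 e.1) 2 E nbr ?_).mono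
    ?_
  · exact fun e _ nbr => ensures_op_bind (ensures_op ⟨rfl, by omega⟩)
  rintro _ t ⟨rfl, ht⟩
  refine ⟨by omega, ?_⟩
  clear ht
  induction E generalizing nbr with
  | nil => simp [Joined, deg]
  | cons e E ih =>
    obtain ⟨ih₁, ih₂⟩ := ih (pushAt (pushAt nbr e.1 e.2) e.2 e.1)
    refine ⟨fun x y => ?_, fun x => ?_⟩
    · rw [List.foldl_cons, ih₁]
      obtain ⟨a, b⟩ := e
      simp only [pushAt, Joined, List.mem_cons, Prod.mk.injEq]
      by_cases hb : x = b <;> by_cases ha : x = a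
      · subst hb; subst ha; simp; tauto
      · subst hb
        simp [ha]; tauto
      · subst ha
        simp [hb]; tauto
      · simp [ha, hb]
    · rw [List.foldl_cons, ih₂, deg_cons]
      obtain ⟨a, b⟩ := e
      simp only [pushAt]
      by_cases hb : x = b <;> by_cases ha : x = a
      · subst hb; subst ha; simp; omega
      · subst hb
        simp [ha, Ne.symm ha]; omega
      · subst ha
        simp [hb, Ne.symm hb]; omega
      · simp [ha, hb, Ne.symm ha, Ne.symm hb]

theorem ensures_vertexList (E : List (Fin n × Fin n)) :
    (vertexList E).Ensures fun vs t => t ≤ 8 * E.length + 2 ∧ vs.Nodup ∧ vs.toFinset = verts E := by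
  let visit : List (Fin n) × (Fin n → Bool) → Fin n → List (Fin n) × (Fin n → Bool) := fun s u =>
    if s.2 u then s else (u :: s.1, Function.update s.2 u true)
  have hbody : ∀ (u : Fin n) (s : List (Fin n) × (Fin n → Bool)),
      Comp.Ensures (do
        let old ← op (s.2 u)
        if old then pure s else op (u :: s.1, Function.update s.2 u true))
      fun s' t => s' = visit s u ∧ t ≤ 2 := by
    intro u s
    refine ensures_op_bind ?_
    by_cases h : s.2 u
    · rw [if_pos h]
      exact ensures_pure ⟨(if_pos h).symm, by omega⟩
    · rw [if_neg h]
      exact ensures_op ⟨(if_neg h).symm, by omega⟩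
  have hloop := ensures_forEach_foldl (fun s e => [e.1, e.2].foldl visit s) 7 E
    (([] : List (Fin n)), fun _ => false) fun e _ s =>
      ensures_forEach_foldl visit 2 [e.1, e.2] s fun u _ s => hbody u s
  unfold vertexList
  refine ensures_op_bind (hloop.bind ?_)
  rintro _ t ⟨rfl, ht⟩
  refine ensures_pure ⟨by omega, ?_⟩
  have hvisit : ∀ (us : List (Fin n)) (s : List (Fin n) × (Fin n → Bool)), s.1.Nodup →
      (∀ x, s.2 x = true ↔ x ∈ s.1) → (us.foldl visit s).1.Nodup ∧
        (∀ x, (us.foldl visit s).2 x = true ↔ x ∈ (us.foldl visit s).1) ∧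
        ∀ x, x ∈ (us.foldl visit s).1 ↔ x ∈ s.1 ∨ x ∈ us := by
    intro us
    induction us with
    | nil => exact fun s h₁ h₂ => ⟨h₁, h₂, by simp⟩
    | cons u us ih =>
      intro s h₁ h₂
      rw [List.foldl_cons]
      by_cases h : s.2 u
      · have hs : visit s u = s := if_pos h
        rw [hs]
        obtain ⟨i₁, i₂, i₃⟩ := ih s h₁ h₂
        refine ⟨i₁, i₂, fun x => ?_⟩
        have := (h₂ u).1 h
        rw [i₃, List.mem_cons]
        constructor
        · tauto
        · rintro (h | rfl | h)
          exacts [.inl h, .inl this, .inr h]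
      · have hs : visit s u = (u :: s.1, Function.update s.2 u true) := if_neg h
        rw [hs]
        obtain ⟨i₁, i₂, i₃⟩ := ih (u :: s.1, Function.update s.2 u true)
          (List.nodup_cons.2 ⟨fun hu => h ((h₂ u).2 hu), h₁⟩) (fun x => by
            by_cases hx : x = u
            · subst hx; simp
            · simp [hx, h₂])
        refine ⟨i₁, i₂, fun x => ?_⟩
        rw [i₃, List.mem_cons, List.mem_cons]
        tauto
  have hfold : ∀ (E : List (Fin n × Fin n)) (s : List (Fin n) × (Fin n → Bool)), s.1.Nodup →
      (∀ x, s.2 x = true ↔ x ∈ s.1) →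
      (E.foldl (fun s e => [e.1, e.2].foldl visit s) s).1.Nodup ∧
        ∀ x, x ∈ (E.foldl (fun s e => [e.1, e.2].foldl visit s) s).1 ↔ x ∈ s.1 ∨ x ∈ verts E := by
    intro E
    induction E with
    | nil => exact fun s h₁ h₂ => ⟨h₁, by simp [verts]⟩
    | cons e E ih =>
      intro s h₁ h₂
      obtain ⟨i₁, i₂, i₃⟩ := hvisit [e.1, e.2] s h₁ h₂
      obtain ⟨j₁, j₂⟩ := ih _ i₁ i₂
      refine ⟨j₁, fun x => ?_⟩
      rw [List.foldl_cons, j₂, i₃]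
      simp only [mem_verts, List.mem_cons, List.not_mem_nil, or_false, exists_eq_or_imp,
        eq_comm (a := x), or_assoc]
  obtain ⟨h₁, h₂⟩ := hfold E ([], fun _ => false) List.nodup_nil (by simp)
  refine ⟨h₁, ?_⟩
  ext x
  rw [List.mem_toFinset, h₂]
  simp

/-! ### Breadth-first search -/

/-- The total length of the adjacency lists of the vertices without a label: the potential that
pays for the steps of breadth-first search. -/
def unseenSize (nbr : Fin n → List (Fin n)) (lab : Fin n → Option (Fin n × ℕ)) : ℕ :=
  ∑ x, if lab x = none then (nbr x).length else 0

theorem unseenSize_update {nbr : Fin n → List (Fin n)} {lab : Fin n → Option (Fin n × ℕ)}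
    {w : Fin n} (hw : lab w = none) (q : Fin n × ℕ) :
    (nbr w).length + unseenSize nbr (Function.update lab w (some q)) = unseenSize nbr lab := by
  unfold unseenSize
  rw [← Finset.add_sum_erase _ _ (Finset.mem_univ w),
    ← Finset.add_sum_erase Finset.univ (fun x => if lab x = none then _ else _)
      (Finset.mem_univ w), if_pos hw, Function.update_self, if_neg (by simp), zero_add]
  congr 1
  refine Finset.sum_congr rfl fun x hx => ?_
  rw [Function.update_of_ne (Finset.ne_of_mem_erase hx)]

/-- The labels `lab` arise from the labels `lab₀` by a search from `root`: the new labels name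
`root` as their root, and a vertex with a new label at distance `d + 1` has a neighbour with a new
label at distance `d`. -/
structure Extends (E : List (Fin n × Fin n)) (root : Fin n)
    (lab₀ lab : Fin n → Option (Fin n × ℕ)) : Prop where
  root_old : lab₀ root = none
  root_new : lab root = some (root, 0)
  old : ∀ x, lab₀ x ≠ none → lab x = lab₀ x
  fst : ∀ x q, lab₀ x = none → lab x = some q → q.1 = root
  zero : ∀ x r, lab₀ x = none → lab x = some (r, 0) → x = root
  succ : ∀ x r d, lab₀ x = none → lab x = some (r, d + 1) →
    ∃ y, Joined E x y ∧ lab₀ y = none ∧ lab y = some (root, d)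

theorem Extends.update {E : List (Fin n × Fin n)} {root u w : Fin n}
    {lab₀ lab : Fin n → Option (Fin n × ℕ)} {d : ℕ} (h : Extends E root lab₀ lab)
    (huw : Joined E u w) (hu₀ : lab₀ u = none) (hu : lab u = some (root, d)) (hw : lab w = none) :
    Extends E root lab₀ (Function.update lab w (some (root, d + 1))) := by
  have hne : ∀ {x q}, lab x = some q → x ≠ w := fun hx hxw => by simp [hxw, hw] at hx
  refine ⟨h.root_old, ?_, fun x hx => ?_, fun x q hx₀ hx => ?_, fun x r hx₀ hx => ?_,
    fun x r d' hx₀ hx => ?_⟩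
  · rw [Function.update_of_ne (hne h.root_new), h.root_new]
  · have := h.old x hx
    rw [Function.update_of_ne (fun hxw => hx (by rw [← this, hxw, hw])), this]
  · by_cases hxw : x = w
    · subst hxw
      rw [Function.update_self] at hx
      rw [← Option.some.inj hx]
    · rw [Function.update_of_ne hxw] at hx
      exact h.fst x q hx₀ hx
  · by_cases hxw : x = w
    · subst hxw
      simp at hx
    · rw [Function.update_of_ne hxw] at hx
      exact h.zero x r hx₀ hx
  · by_cases hxw : x = w
    · subst hxw
      rw [Function.update_self] at hx
      obtain ⟨-, rfl⟩ : root = r ∧ d = d' := by simpa using hx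
      exact ⟨u, huw.symm, hu₀, by rw [Function.update_of_ne (hne hu), hu]⟩
    · rw [Function.update_of_ne hxw] at hx
      obtain ⟨y, hy, hy₀, hyd⟩ := h.succ x r d' hx₀ hx
      exact ⟨y, hy, hy₀, by rw [Function.update_of_ne (hne hyd), hyd]⟩

/-- A distance that occurs as a label is at most the number of edges: each smaller distance is the
smaller one of the two labels at the ends of some edge. -/
theorem Extends.dist_le {E : List (Fin n × Fin n)} {root : Fin n}
    {lab₀ lab : Fin n → Option (Fin n × ℕ)} (h : Extends E root lab₀ lab) {x r : Fin n} {d : ℕ}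
    (hx₀ : lab₀ x = none) (hx : lab x = some (r, d)) : d ≤ E.length := by
  let dist : Fin n → ℕ := fun x => ((lab x).map Prod.snd).getD 0
  let low : Fin n × Fin n → ℕ := fun e => min (dist e.1) (dist e.2)
  have key : ∀ d x r, lab₀ x = none → lab x = some (r, d) →
      Finset.range d ⊆ (E.map low).toFinset := by
    intro d
    induction d with
    | zero => simp
    | succ d ih =>
      intro x r hx₀ hx
      obtain ⟨y, hxy, hy₀, hy⟩ := h.succ x r d hx₀ hx
      rw [Finset.range_add_one, Finset.insert_subset_iff]
      refine ⟨?_, ih y root hy₀ hy⟩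
      rw [List.mem_toFinset, List.mem_map]
      have dx : dist x = d + 1 := by simp [dist, hx]
      have dy : dist y = d := by simp [dist, hy]
      rcases hxy with hxy | hxy
      · exact ⟨_, hxy, by simp [low, dx, dy]⟩
      · exact ⟨_, hxy, by simp [low, dx, dy]⟩
  calc d = (Finset.range d).card := (Finset.card_range d).symm
    _ ≤ (E.map low).toFinset.card := Finset.card_le_card (key d x r hx₀ hx)
    _ ≤ (E.map low).length := List.toFinset_card_le _
    _ = E.length := List.length_map _

/-- Every vertex labelled by the search has a neighbour, if the root has one. -/
theorem Extends.exists_joined {E : List (Fin n × Fin n)} {root : Fin n}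
    {lab₀ lab : Fin n → Option (Fin n × ℕ)} (h : Extends E root lab₀ lab)
    (hroot : ∃ y, Joined E root y) {x : Fin n} {q : Fin n × ℕ} (hx₀ : lab₀ x = none)
    (hx : lab x = some q) : ∃ y, Joined E x y := by
  obtain ⟨r, d⟩ := q
  cases d with
  | zero => exact h.zero x r hx₀ hx ▸ hroot
  | succ d =>
    obtain ⟨y, hy, -⟩ := h.succ x r d hx₀ hx
    exact ⟨y, hy⟩

/-- The state of a search while the layer at distance `d` is processed: `todo` is the rest of the
layer, `s.1` the part of the next layer that has been found, `s.2` are the labels; the pairs with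
`P` still have to be examined. -/
structure LayerState (E : List (Fin n × Fin n)) (nbr : Fin n → List (Fin n)) (root : Fin n)
    (lab₀ : Fin n → Option (Fin n × ℕ)) (d size : ℕ) (todo : List (Fin n))
    (P : Fin n → Fin n → Prop) (s : List (Fin n) × (Fin n → Option (Fin n × ℕ))) : Prop where
  extend : Extends E root lab₀ s.2
  todo_lab : ∀ x ∈ todo, lab₀ x = none ∧ s.2 x = some (root, d)
  next_lab : ∀ x ∈ s.1, lab₀ x = none ∧ s.2 x = some (root, d + 1)
  closed : ∀ x y, Joined E x y → s.2 x ≠ none → s.2 y ≠ none ∨ x ∈ todo ∨ x ∈ s.1 ∨ P x y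
  size_eq : (s.1.map fun x => (nbr x).length).sum + unseenSize nbr s.2 = size

/-- Processing one vertex `u` of the layer. In the loop, the pairs that still have to be examined
are those of `u` with the rest of its adjacency list. -/
theorem ensures_visitNeighbours {E : List (Fin n × Fin n)} {nbr : Fin n → List (Fin n)}
    (hnbr : ∀ x y, y ∈ nbr x ↔ Joined E x y) {root : Fin n}
    {lab₀ : Fin n → Option (Fin n × ℕ)} {d size : ℕ} {todo : List (Fin n)} {u : Fin n}
    {s : List (Fin n) × (Fin n → Option (Fin n × ℕ))}
    (hs : LayerState E nbr root lab₀ d size (u :: todo) (fun _ _ => False) s) :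
    (forEach (nbr u) s fun w s => do
      let seen ← op (s.2 w).isSome
      if seen then pure s else op (w :: s.1, Function.update s.2 w (some (root, d + 1)))).Ensures
    fun s' t => LayerState E nbr root lab₀ d size todo (fun _ _ => False) s' ∧
      t ≤ 3 * (nbr u).length + 1 := by
  have key := ensures_forEach (l := nbr u) (s := s) (t := 0) (body := fun w s => do
      let seen ← op (s.2 w).isSome
      if seen then pure s else op (w :: s.1, Function.update s.2 w (some (root, d + 1))))
    (Inv := fun rem s t => LayerState E nbr root lab₀ d size todo (fun x y => x = u ∧ y ∈ rem) s ∧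
      (lab₀ u = none ∧ s.2 u = some (root, d)) ∧ (∀ w ∈ rem, Joined E u w) ∧
      t + 3 * rem.length ≤ 3 * (nbr u).length) ?_ ?_
  · refine key.mono ?_
    rintro s' _ ⟨t, rfl, h, -, -, ht⟩
    refine ⟨⟨h.extend, h.todo_lab, h.next_lab, fun x y hxy hx => ?_, h.size_eq⟩, ?_⟩
    · simpa using h.closed x y hxy hx
    · simp only [List.length_nil] at ht
      omega
  · rintro w rem s t ⟨h, ⟨hu₀, hu⟩, hrem, ht⟩
    rw [List.length_cons] at ht
    refine ensures_op_bind ?_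
    by_cases hw : s.2 w = none
    · rw [if_neg (by simp [hw])]
      have hw₀ : lab₀ w = none := by
        by_contra hne
        exact hne (by rw [← h.extend.old w hne, hw])
      have hne : ∀ {x q}, s.2 x = some q → x ≠ w := fun hx hxw => by simp [hxw, hw] at hx
      have hkeep : ∀ {x}, x ≠ w → Function.update s.2 w (some (root, d + 1)) x = s.2 x :=
        fun hx => Function.update_of_ne hx ..
      refine ensures_op ⟨⟨h.extend.update (hrem w (by simp)) hu₀ hu hw, fun x hx => ?_,
        fun x hx => ?_, fun x y hxy hx => ?_, ?_⟩, ⟨hu₀, ?_⟩, fun v hv => hrem v (by simp [hv]), ?_⟩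
      · obtain ⟨h₁, h₂⟩ := h.todo_lab x hx
        exact ⟨h₁, (hkeep (hne h₂)).trans h₂⟩
      · rcases List.mem_cons.1 hx with rfl | hx
        · exact ⟨hw₀, Function.update_self ..⟩
        · obtain ⟨h₁, h₂⟩ := h.next_lab x hx
          exact ⟨h₁, (hkeep (hne h₂)).trans h₂⟩
      · by_cases hxw : x = w
        · exact .inr (.inr (.inl (by simp [hxw])))
        · replace hx : s.2 x ≠ none := hkeep hxw ▸ hx
          by_cases hyw : y = w
          · exact .inl (by simp [hyw])
          · have := h.closed x y hxy hx
            rw [← hkeep hyw] at this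
            simp only [List.mem_cons, hyw, false_or] at this ⊢
            tauto
      · have := unseenSize_update (nbr := nbr) hw (root, d + 1)
        have := h.size_eq
        simp only [List.map_cons, List.sum_cons]
        omega
      · exact (hkeep (hne hu)).trans hu
      · omega
    · rw [if_pos (by simpa [Option.isSome_iff_ne_none] using hw)]
      refine ensures_pure ⟨⟨h.extend, h.todo_lab, h.next_lab, fun x y hxy hx => ?_, h.size_eq⟩,
        ⟨hu₀, hu⟩, fun v hv => hrem v (by simp [hv]), by omega⟩
      rcases h.closed x y hxy hx with h | h | h | ⟨hxu, hyrem⟩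
      · exact .inl h
      · exact .inr (.inl h)
      · exact .inr (.inr (.inl h))
      · rcases List.mem_cons.1 hyrem with rfl | hy
        · exact .inl hw
        · exact .inr (.inr (.inr ⟨hxu, hy⟩))
  · refine ⟨⟨hs.extend, fun x hx => hs.todo_lab x (by simp [hx]), hs.next_lab,
      fun x y hxy hx => ?_, hs.size_eq⟩, hs.todo_lab u (by simp), fun w hw => (hnbr u w).1 hw,
      by omega⟩
    rcases hs.closed x y hxy hx with h | h | h | h
    · exact .inl h
    · rcases List.mem_cons.1 h with rfl | h
      · exact .inr (.inr (.inr ⟨rfl, (hnbr x y).2 hxy⟩))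
      · exact .inr (.inl h)
    · exact .inr (.inr (.inl h))
    · exact h.elim

/-- The hypothesis `b + d = E.length + 1` ties the bound `b` for the number of layers to the
distance `d` of the current one, so that the bound is not reached before the layer is empty. -/
theorem ensures_bfsLayers {E : List (Fin n × Fin n)} {nbr : Fin n → List (Fin n)}
    (hnbr : ∀ x y, y ∈ nbr x ↔ Joined E x y) {root : Fin n} (hroot : ∃ y, Joined E root y)
    {lab₀ : Fin n → Option (Fin n × ℕ)} :
    ∀ (b d : ℕ) (layer : List (Fin n)) (lab : Fin n → Option (Fin n × ℕ)),
      b + d = E.length + 1 → Extends E root lab₀ lab →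
      (∀ x ∈ layer, lab₀ x = none ∧ lab x = some (root, d)) →
      (∀ x y, Joined E x y → lab x ≠ none → lab y ≠ none ∨ x ∈ layer) →
      (bfsLayers nbr root b d layer lab).Ensures fun lab' t => Extends E root lab₀ lab' ∧
        (∀ x y, Joined E x y → lab' x ≠ none → lab' y ≠ none) ∧
        t + 6 * unseenSize nbr lab'
          ≤ 6 * (layer.map fun x => (nbr x).length).sum + 6 * unseenSize nbr lab + 1 := by
  intro b
  induction b with
  | zero =>
    intro d layer lab hbd hext hlayer hclosed
    -- A vertex of the layer would have a label beyond the number of edges.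
    have hnil : ∀ x, x ∉ layer := fun x hx => by
      have := hext.dist_le (hlayer x hx).1 (hlayer x hx).2
      omega
    unfold bfsLayers
    exact ensures_op ⟨hext, fun x y hxy hx => (hclosed x y hxy hx).resolve_right (hnil x), by omega⟩
  | succ b ih =>
    intro d layer lab hbd hext hlayer hclosed
    match layer with
    | [] =>
      unfold bfsLayers
      exact ensures_op ⟨hext, fun x y hxy hx => (hclosed x y hxy hx).resolve_right (by simp),
        by omega⟩
    | u :: us =>
      unfold bfsLayers
      have hpos : ∀ x ∈ u :: us, 1 ≤ (nbr x).length := fun x hx => by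
        obtain ⟨y, hy⟩ := hext.exists_joined hroot (hlayer x hx).1 (hlayer x hx).2
        exact List.length_pos_of_mem ((hnbr x y).2 hy)
      have key := ensures_forEach (l := u :: us) (s := (([] : List (Fin n)), lab)) (t := 0)
        (body := fun u s => forEach (nbr u) s fun w s => do
          let seen ← op (s.2 w).isSome
          if seen then pure s else op (w :: s.1, Function.update s.2 w (some (root, d + 1))))
        (Inv := fun rem s t =>
          LayerState E nbr root lab₀ d (unseenSize nbr lab) rem (fun _ _ => False) s ∧
          (∀ x ∈ rem, 1 ≤ (nbr x).length) ∧
          t + 5 * (rem.map fun x => (nbr x).length).sum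
            ≤ 5 * ((u :: us).map fun x => (nbr x).length).sum) ?_ ?_
      · refine key.bind ?_
        rintro s _ ⟨t, rfl, hs, -, ht⟩
        refine (ih (d + 1) s.1 s.2 (by omega) hs.extend hs.next_lab fun x y hxy hx => ?_).mono ?_
        · simpa using hs.closed x y hxy hx
        · rintro lab' t' ⟨h₁, h₂, h₃⟩
          refine ⟨h₁, h₂, ?_⟩
          have := hs.size_eq
          have := hpos u (by simp)
          simp only [List.map_cons, List.sum_cons, List.map_nil, List.sum_nil] at ht h₃ ⊢
          omega
      · rintro v rem s t ⟨hs, hrem, ht⟩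
        refine (ensures_visitNeighbours hnbr hs).mono ?_
        rintro s' t' ⟨hs', ht'⟩
        refine ⟨hs', fun x hx => hrem x (by simp [hx]), ?_⟩
        have := hrem v (by simp)
        simp only [List.map_cons, List.sum_cons] at ht ⊢
        omega
      · refine ⟨⟨hext, hlayer, by simp, fun x y hxy hx => ?_, by simp⟩, hpos, by omega⟩
        rcases hclosed x y hxy hx with h | h
        exacts [.inl h, .inr (.inl h)]

/-- Breadth-first search from an unlabelled root, started when the labelled vertices form a union
of connected components. The step count is paid by the drop of the potential. -/
theorem ensures_bfs {E : List (Fin n × Fin n)} {nbr : Fin n → List (Fin n)}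
    (hnbr : ∀ x y, y ∈ nbr x ↔ Joined E x y) {root : Fin n} (hroot : ∃ y, Joined E root y)
    {lab₀ : Fin n → Option (Fin n × ℕ)} (h₀ : lab₀ root = none)
    (hclosed : ∀ x y, Joined E x y → lab₀ x ≠ none → lab₀ y ≠ none) :
    (bfs E nbr root lab₀).Ensures fun lab t => Extends E root lab₀ lab ∧
      (∀ x y, Joined E x y → lab x ≠ none → lab y ≠ none) ∧
      t + 6 * unseenSize nbr lab ≤ 6 * unseenSize nbr lab₀ + 2 := by
  have hne : ∀ {x}, x ≠ root → Function.update lab₀ root (some (root, 0)) x = lab₀ x :=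
    fun hx => Function.update_of_ne hx ..
  have hext : Extends E root lab₀ (Function.update lab₀ root (some (root, 0))) := by
    refine ⟨h₀, Function.update_self .., fun x hx => hne ?_, fun x q hx₀ hx => ?_,
      fun x r hx₀ hx => ?_, fun x r d hx₀ hx => ?_⟩
    · rintro rfl
      exact hx h₀
    all_goals
      by_cases hxr : x = root
      · subst hxr
        simp_all [eq_comm]
      · rw [hne hxr, hx₀] at hx
        simp at hx
  unfold bfs
  refine ensures_op_bind ((ensures_bfsLayers hnbr hroot (lab₀ := lab₀) (E.length + 1) 0 [root] _
    (by omega) hext (by simp [h₀]) fun x y hxy hx => ?_).mono ?_)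
  · by_cases hxr : x = root
    · simp [hxr]
    · rw [hne hxr] at hx
      by_cases hyr : y = root
      · simp [hyr]
      · rw [hne hyr]
        exact .inl (hclosed x y hxy hx)
  · rintro lab t ⟨h₁, h₂, h₃⟩
    refine ⟨h₁, h₂, ?_⟩
    have := unseenSize_update (nbr := nbr) h₀ (root, 0)
    simp only [List.map_cons, List.map_nil, List.sum_cons, List.sum_nil] at h₃
    omega

/-! ### Connected components -/

/-- The labels `lab` are those of a breadth-first forest with the given roots, each tree of which
spans a connected component: the ends of an edge with a labelled end have the same root. -/
structure SpanningForest (E : List (Fin n × Fin n)) (roots : List (Fin n))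
    (lab : Fin n → Option (Fin n × ℕ)) : Prop where
  nodup : roots.Nodup
  root : ∀ r ∈ roots, lab r = some (r, 0) ∧ ∃ e ∈ E, e.1 = r ∨ e.2 = r
  mem : ∀ x r d, lab x = some (r, d) → r ∈ roots
  zero : ∀ x r, lab x = some (r, 0) → x = r
  succ : ∀ x r d, lab x = some (r, d + 1) → ∃ y, Joined E x y ∧ lab y = some (r, d)
  closed : ∀ x y r d, Joined E x y → lab x = some (r, d) → ∃ d', lab y = some (r, d')

theorem SpanningForest.nil (E : List (Fin n × Fin n)) : SpanningForest E [] fun _ => none := by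
  constructor <;> simp

theorem SpanningForest.ne_none {E : List (Fin n × Fin n)} {roots : List (Fin n)}
    {lab : Fin n → Option (Fin n × ℕ)} (h : SpanningForest E roots lab) {x y : Fin n}
    (hxy : Joined E x y) (hx : lab x ≠ none) : lab y ≠ none := by
  obtain ⟨⟨r, d⟩, hq⟩ := Option.ne_none_iff_exists'.1 hx
  obtain ⟨d', hd'⟩ := h.closed x y r d hxy hq
  simp [hd']

theorem SpanningForest.extend {E : List (Fin n × Fin n)} {roots : List (Fin n)} {root : Fin n}
    {lab₀ lab : Fin n → Option (Fin n × ℕ)} (h : SpanningForest E roots lab₀)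
    (hext : Extends E root lab₀ lab) (hclosed : ∀ x y, Joined E x y → lab x ≠ none → lab y ≠ none)
    (hroot : ∃ e ∈ E, e.1 = root ∨ e.2 = root) : SpanningForest E (root :: roots) lab := by
  have hold : ∀ {x r d}, lab₀ x = some (r, d) → lab x = some (r, d) := fun hx => by
    rw [hext.old _ (by simp [hx]), hx]
  have hback : ∀ {x r d}, lab₀ x ≠ none → lab x = some (r, d) → lab₀ x = some (r, d) :=
    fun hx hx' => by rw [← hext.old _ hx, hx']
  refine ⟨List.nodup_cons.2 ⟨fun hr => ?_, h.nodup⟩, fun r hr => ?_, fun x r d hx => ?_,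
    fun x r hx => ?_, fun x r d hx => ?_, fun x y r d hxy hx => ?_⟩
  · have := (h.root root hr).1
    rw [hext.root_old] at this
    simp at this
  · rcases List.mem_cons.1 hr with rfl | hr
    · exact ⟨hext.root_new, hroot⟩
    · exact ⟨hold (h.root r hr).1, (h.root r hr).2⟩
  · by_cases hx₀ : lab₀ x = none
    · have : r = root := hext.fst x _ hx₀ hx
      simp [this]
    · simp [h.mem x r d (hback hx₀ hx)]
  · by_cases hx₀ : lab₀ x = none
    · have : r = root := hext.fst x _ hx₀ hx
      rw [this]
      exact hext.zero x r hx₀ hx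
    · exact h.zero x r (hback hx₀ hx)
  · by_cases hx₀ : lab₀ x = none
    · have : r = root := hext.fst x _ hx₀ hx
      obtain ⟨y, hxy, -, hy⟩ := hext.succ x r d hx₀ hx
      exact ⟨y, hxy, this ▸ hy⟩
    · obtain ⟨y, hxy, hy⟩ := h.succ x r d (hback hx₀ hx)
      exact ⟨y, hxy, hold hy⟩
  · by_cases hx₀ : lab₀ x = none
    · have hr : r = root := hext.fst x _ hx₀ hx
      have hy₀ : lab₀ y = none := by
        by_contra hy
        exact h.ne_none hxy.symm hy hx₀
      obtain ⟨⟨r', d'⟩, hy⟩ := Option.ne_none_iff_exists'.1 (hclosed x y hxy (by simp [hx]))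
      have hr' : r' = root := hext.fst y _ hy₀ hy
      exact ⟨d', by rw [hy, hr', hr]⟩
    · obtain ⟨d', hd'⟩ := h.closed x y r d hxy (hback hx₀ hx)
      exact ⟨d', hold hd'⟩

/-- The edges of `E` whose first end is in the tree with root `r`, in the order in which
`components` collects them. -/
def treeEdges (E : List (Fin n × Fin n)) (lab : Fin n → Option (Fin n × ℕ)) (r : Fin n) :
    List (Fin n × Fin n) :=
  (E.filter fun e => (lab e.1).map Prod.fst = some r).reverse

theorem mem_treeEdges {E : List (Fin n × Fin n)} {lab : Fin n → Option (Fin n × ℕ)} {r : Fin n}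
    {e : Fin n × Fin n} : e ∈ treeEdges E lab r ↔ e ∈ E ∧ ∃ d, lab e.1 = some (r, d) := by
  simp [treeEdges, Option.map_eq_some_iff]

theorem treeEdges_subperm (E : List (Fin n × Fin n)) (lab : Fin n → Option (Fin n × ℕ))
    (r : Fin n) : (treeEdges E lab r).Subperm E :=
  (List.reverse_perm _).subperm.trans List.filter_sublist.subperm

/-- The lists `cs` are edge lists of connected parts of the graph with edge list `E` that have no
vertices in common. -/
structure IsDecomposition (E : List (Fin n × Fin n)) (cs : List (List (Fin n × Fin n))) :
    Prop where
  ne_nil : ∀ C ∈ cs, C ≠ []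
  conn : ∀ C ∈ cs, Conn C
  subperm : ∀ C ∈ cs, C.Subperm E
  sum_length : (cs.map List.length).sum ≤ E.length
  sum_card : (cs.map fun C => (verts C).card).sum ≤ (verts E).card

theorem sum_length_filter_le {α β : Type} [DecidableEq β] (s : Finset β) (g : α → Option β)
    (E : List α) : ∑ r ∈ s, (E.filter fun e => g e = some r).length ≤ E.length := by
  induction E with
  | nil => simp
  | cons e E ih =>
    have h : ∀ r, ((e :: E).filter fun e => g e = some r).length
        = (E.filter fun e => g e = some r).length + if g e = some r then 1 else 0 := fun r => by
      by_cases hr : g e = some r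
      · simp [hr]
      · simp [hr]
    have h₁ : ∑ r ∈ s, (if g e = some r then 1 else 0) ≤ 1 := by
      rw [← Finset.card_filter, Finset.card_le_one]
      intro a ha b hb
      have ha := (Finset.mem_filter.1 ha).2
      have hb := (Finset.mem_filter.1 hb).2
      exact Option.some.inj (ha.symm.trans hb)
    simp only [h, Finset.sum_add_distrib, List.length_cons]
    omega

theorem SpanningForest.isDecomposition {E : List (Fin n × Fin n)} {roots : List (Fin n)}
    {lab : Fin n → Option (Fin n × ℕ)} (h : SpanningForest E roots lab)
    (cs : List (List (Fin n × Fin n))) (hcs : cs.Perm (roots.map (treeEdges E lab))) :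
    IsDecomposition E cs := by
  have hmem : ∀ C ∈ cs, ∃ r ∈ roots, treeEdges E lab r = C := fun C hC =>
    List.mem_map.1 (hcs.mem_iff.1 hC)
  have hsnd : ∀ {e r d}, e ∈ E → lab e.1 = some (r, d) → ∃ d', lab e.2 = some (r, d') :=
    fun he hd => h.closed _ _ _ _ (.inl he) hd
  refine ⟨fun C hC => ?_, fun C hC => ?_, fun C hC => ?_, ?_, ?_⟩
  · obtain ⟨r, hr, rfl⟩ := hmem C hC
    obtain ⟨h₁, e, he, her⟩ := h.root r hr
    refine List.ne_nil_of_mem (a := e) (mem_treeEdges.2 ⟨he, ?_⟩)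
    rcases her with rfl | rfl
    · exact ⟨0, h₁⟩
    · exact h.closed _ _ _ _ (.inr he) h₁
  · obtain ⟨r, hr, rfl⟩ := hmem C hC
    intro S hS
    have key : ∀ d x, lab x = some (r, d) → (S x ↔ S r) := by
      intro d
      induction d with
      | zero => exact fun x hx => by rw [h.zero x r hx]
      | succ d ih =>
        intro x hx
        obtain ⟨y, hxy, hy⟩ := h.succ x r d hx
        rw [← ih y hy]
        rcases hxy with hxy | hxy
        · exact hS _ (mem_treeEdges.2 ⟨hxy, _, hx⟩)
        · exact (hS _ (mem_treeEdges.2 ⟨hxy, _, hy⟩)).symm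
    intro e he hSe e' he'
    obtain ⟨-, d, hd⟩ := mem_treeEdges.1 he
    obtain ⟨-, d', hd'⟩ := mem_treeEdges.1 he'
    exact (key d' _ hd').2 ((key d _ hd).1 hSe)
  · obtain ⟨r, hr, rfl⟩ := hmem C hC
    exact treeEdges_subperm E lab r
  · rw [(hcs.map _).sum_eq, List.map_map, ← List.sum_toFinset _ h.nodup]
    refine le_trans (Finset.sum_le_sum fun r _ => ?_)
      (sum_length_filter_le roots.toFinset (fun e => (lab e.1).map Prod.fst) E)
    simp [treeEdges]
  · rw [(hcs.map _).sum_eq, List.map_map, ← List.sum_toFinset _ h.nodup]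
    have hroot : ∀ r x, x ∈ verts (treeEdges E lab r) → (lab x).map Prod.fst = some r := by
      intro r x hx
      obtain ⟨e, he, hex⟩ := mem_verts.1 hx
      obtain ⟨he, d, hd⟩ := mem_treeEdges.1 he
      rcases hex with rfl | rfl
      · simp [hd]
      · obtain ⟨d', hd'⟩ := hsnd he hd
        simp [hd']
    rw [Finset.sum_congr rfl fun r _ => Function.comp_apply, ← Finset.card_biUnion]
    · exact Finset.card_le_card (Finset.biUnion_subset.2 fun r _ =>
        verts_mono (treeEdges_subperm E lab r).subset)
    · intro r _ r' _ hrr'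
      refine Finset.disjoint_left.2 fun x hx hx' => hrr' ?_
      exact Option.some.inj ((hroot r x hx).symm.trans (hroot r' x hx'))

theorem foldl_pushAt {E : List (Fin n × Fin n)} {lab : Fin n → Option (Fin n × ℕ)}
    (b : Fin n → List (Fin n × Fin n)) (r : Fin n) :
    E.foldl (fun b e => match lab e.1 with
      | some (r, _) => pushAt b r e
      | none => b) b r = treeEdges E lab r ++ b r := by
  induction E generalizing b with
  | nil => simp [treeEdges]
  | cons e E ih =>
    rw [List.foldl_cons, ih]
    rcases hq : lab e.1 with _ | ⟨r', d⟩
    · simp [treeEdges, hq]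
    · by_cases hr : r = r'
      · subst hr
        simp [treeEdges, hq, pushAt]
      · simp [treeEdges, hq, pushAt, hr, Ne.symm hr]

theorem ensures_components (E : List (Fin n × Fin n)) :
    (components E).Ensures fun cs t => t ≤ 24 * E.length + 7 ∧ IsDecomposition E cs := by
  unfold components
  refine ensures_op_bind ((ensures_adjLists E _).bind ?_)
  rintro nbr t₁ ⟨ht₁, hnbr, hlen⟩
  replace hnbr : ∀ x y, y ∈ nbr x ↔ Joined E x y := by simpa using hnbr
  have hsize : unseenSize nbr (fun _ => none) = 2 * E.length := by
    rw [← sum_deg]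
    simp [unseenSize, hlen]
  refine ensures_op_bind ?_
  have key := ensures_forEach (l := E) (s := (([] : List (Fin n)), fun _ : Fin n => none)) (t := 0)
    (body := fun e s => do
      let seen ← op (s.2 e.1).isSome
      if seen then pure s
      else do
        let lab ← bfs E nbr e.1 s.2
        op (e.1 :: s.1, lab))
    (Inv := fun rem s t => SpanningForest E s.1 s.2 ∧ (∀ e ∈ rem, e ∈ E) ∧
      (∀ e ∈ E, e ∈ rem ∨ s.2 e.1 ≠ none) ∧ s.1.length + rem.length ≤ E.length ∧
      t + 6 * unseenSize nbr s.2 + 5 * rem.length ≤ 5 * E.length + 12 * E.length) ?_ ?_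
  · refine key.bind ?_
    rintro ⟨roots, lab⟩ _ ⟨t₂, rfl, hforest, -, hall, hroots, ht₂⟩
    replace hall : ∀ e ∈ E, lab e.1 ≠ none := by simpa using hall
    simp only [List.length_nil] at hroots ht₂
    have hbucket := ensures_forEach_foldl (body := fun e bucket => match lab e.1 with
        | some (r, _) => op (pushAt bucket r e)
        | none => stuck)
      (fun b e => match lab e.1 with
        | some (r, _) => pushAt b r e
        | none => b) 1 E (fun _ : Fin n => ([] : List (Fin n × Fin n))) fun e he b => by
        obtain ⟨⟨r, d⟩, hq⟩ := Option.ne_none_iff_exists'.1 (hall e he)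
        simp only [hq]
        exact ensures_op ⟨rfl, le_rfl⟩
    refine ensures_op_bind (hbucket.bind ?_)
    rintro bucket t₃ ⟨hbucket, ht₃⟩
    refine (ensures_forEach_foldl (fun cs r => bucket r :: cs) 1 roots []
      fun r _ cs => ensures_op ⟨rfl, le_rfl⟩).mono ?_
    rintro cs t₄ ⟨rfl, ht₄⟩
    refine ⟨by omega, hforest.isDecomposition _ ?_⟩
    have hb : bucket = treeEdges E lab := by
      funext r
      rw [hbucket, foldl_pushAt]
      simp
    simp [hb]
  · rintro e rem ⟨roots, lab⟩ t ⟨hforest, hrem, hall, hroots, ht⟩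
    have he : e ∈ E := hrem e (by simp)
    simp only [List.length_cons] at hroots ht
    refine ensures_op_bind ?_
    by_cases hs : lab e.1 = none
    · rw [if_neg (by simp [hs])]
      refine (ensures_bfs hnbr ⟨e.2, .inl he⟩ hs fun x y => hforest.ne_none).bind ?_
      rintro lab' t' ⟨hext, hclosed, ht'⟩
      refine ensures_op ⟨hforest.extend hext hclosed ⟨e, he, .inl rfl⟩,
        fun f hf => hrem f (by simp [hf]), fun f hf => ?_, ?_, ?_⟩
      · rcases hall f hf with h | h
        · rcases List.mem_cons.1 h with rfl | h
          · right
            simp [hext.root_new]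
          · exact .inl h
        · right
          change lab' f.1 ≠ none
          rwa [hext.old _ h]
      · simp only [List.length_cons]
        omega
      · dsimp only at ht ⊢
        omega
    · rw [if_pos (by simpa [Option.isSome_iff_ne_none] using hs)]
      refine ensures_pure ⟨hforest, fun f hf => hrem f (by simp [hf]), fun f hf => ?_, by
        dsimp only at hroots ⊢
        omega, by
        dsimp only at ht ⊢
        omega⟩
      rcases hall f hf with h | h
      · rcases List.mem_cons.1 h with rfl | h
        exacts [.inr hs, .inl h]
      · exact .inr h
  · exact ⟨.nil E, fun e he => he, fun e he => .inl he, by simp, by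
      dsimp only
      omega⟩

/-! ### Edges directed away from a source -/

/-- The edges that the source `v` leaves undirected form a graph without `v` in which every vertex
has lost an edge: the one towards a vertex nearer to `v`. -/
theorem ensures_flowed {E : List (Fin n × Fin n)} (hloop : ∀ e ∈ E, e.1 ≠ e.2) (hconn : Conn E)
    {v : Fin n} (hv : v ∈ verts E) :
    (flowed E v).Ensures fun F t => t ≤ 17 * E.length + 7 ∧ F.1.length + F.2.length = E.length ∧
      F.2.Subperm E ∧ v ∉ verts F.2 ∧ ∀ x ∈ verts F.2, deg F.2 x < deg E x := by
  unfold flowed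
  refine ensures_op_bind ((ensures_adjLists E _).bind ?_)
  rintro nbr t₁ ⟨ht₁, hnbr, hlen⟩
  replace hnbr : ∀ x y, y ∈ nbr x ↔ Joined E x y := by simpa using hnbr
  have hsize : unseenSize nbr (fun _ => none) = 2 * E.length := by
    rw [← sum_deg]
    simp [unseenSize, hlen]
  obtain ⟨e₀, he₀, hev⟩ := mem_verts.1 hv
  have hroot : ∃ y, Joined E v y := by
    rcases hev with rfl | rfl
    exacts [⟨e₀.2, .inl he₀⟩, ⟨e₀.1, .inr he₀⟩]
  refine ensures_op_bind ((ensures_bfs hnbr hroot rfl fun x y _ hx => absurd rfl hx).bind ?_)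
  rintro lab t₂ ⟨hext, hclosed, ht₂⟩
  have hforest := (SpanningForest.nil E).extend hext hclosed ⟨e₀, he₀, hev⟩
  have hall₁ : ∀ e ∈ E, lab e.1 ≠ none := by
    refine hconn (fun x => lab x ≠ none)
      (fun e he => ⟨hclosed _ _ (.inl he), hclosed _ _ (.inr he)⟩) e₀ he₀ ?_
    rcases hev with rfl | rfl
    · simp [hext.root_new]
    · exact hclosed _ _ (.inr he₀) (by simp [hext.root_new])
  have hall₂ : ∀ e ∈ E, lab e.2 ≠ none := fun e he => hclosed _ _ (.inl he) (hall₁ e he)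
  -- All vertices of `E` are labelled, so the default value `0` is not used on them.
  let dist : Fin n → ℕ := fun x => ((lab x).map Prod.snd).getD 0
  let f : List (Fin n × Fin n) × List (Fin n × Fin n) → Fin n × Fin n →
      List (Fin n × Fin n) × List (Fin n × Fin n) := fun s e =>
    if dist e.1 < dist e.2 then ((e.1, e.2) :: s.1, s.2)
    else if dist e.2 < dist e.1 then ((e.2, e.1) :: s.1, s.2) else (s.1, e :: s.2)
  have hfold := ensures_forEach_foldl (body := fun e s => match lab e.1, lab e.2 with
      | some (_, d₁), some (_, d₂) =>
        if d₁ < d₂ then op ((e.1, e.2) :: s.1, s.2)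
        else if d₂ < d₁ then op ((e.2, e.1) :: s.1, s.2)
        else op (s.1, e :: s.2)
      | _, _ => stuck) f 1 E ([], []) fun e he s => by
    obtain ⟨⟨r₁, d₁⟩, h₁⟩ := Option.ne_none_iff_exists'.1 (hall₁ e he)
    obtain ⟨⟨r₂, d₂⟩, h₂⟩ := Option.ne_none_iff_exists'.1 (hall₂ e he)
    have e₁ : dist e.1 = d₁ := by simp [dist, h₁]
    have e₂ : dist e.2 = d₂ := by simp [dist, h₂]
    simp only [h₁, h₂, f, e₁, e₂]
    split_ifs <;> exact ensures_op ⟨rfl, le_rfl⟩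
  refine hfold.mono ?_
  rintro F t₃ ⟨rfl, ht₃⟩
  have hF : ∀ (E : List (Fin n × Fin n)) s,
      (E.foldl f s).2 = (E.filter fun e => dist e.1 = dist e.2).reverse ++ s.2 ∧
      (E.foldl f s).1.length + (E.foldl f s).2.length = E.length + s.1.length + s.2.length := by
    intro E
    induction E with
    | nil => simp
    | cons e E ih =>
      intro s
      rw [List.foldl_cons, (ih _).1, ← (ih _).1, (ih _).2]
      have hlt : ∀ a b : ℕ, a < b → a ≠ b := fun a b h => h.ne
      simp only [f]
      split_ifs with h₁ h₂
      · rw [(ih _).1]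
        simp [hlt _ _ h₁]
        omega
      · rw [(ih _).1]
        simp [(hlt _ _ h₂).symm]
        omega
      · have : dist e.1 = dist e.2 := by omega
        rw [(ih _).1]
        simp [this]
        omega
  obtain ⟨hF₂, hFlen⟩ := hF E ([], [])
  rw [List.append_nil] at hF₂
  simp only [List.length_nil, add_zero] at hFlen
  have hmem : ∀ e ∈ (E.foldl f ([], [])).2, e ∈ E ∧ dist e.1 = dist e.2 := fun e he => by
    rw [hF₂] at he
    simpa using he
  have hdist : ∀ x, lab x ≠ none → dist x = 0 → x = v := by
    intro x hx hd
    obtain ⟨⟨r, d⟩, hq⟩ := Option.ne_none_iff_exists'.1 hx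
    have : d = 0 := by simpa [dist, hq] using hd
    subst this
    exact hext.zero x r rfl hq
  -- Only `v` has distance `0`, so an undirected edge at `v` would be a loop.
  have hpos : ∀ x ∈ verts (E.foldl f ([], [])).2, lab x ≠ none ∧ dist x ≠ 0 := by
    intro x hx
    obtain ⟨e, he, hex⟩ := mem_verts.1 hx
    obtain ⟨he, hd⟩ := hmem e he
    refine ⟨?_, fun h₀ => hloop e he ?_⟩
    · rcases hex with rfl | rfl
      exacts [hall₁ e he, hall₂ e he]
    · have h₁ : dist e.1 = 0 := by
        rcases hex with rfl | rfl
        exacts [h₀, hd.trans h₀]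
      rw [hdist e.1 (hall₁ e he) h₁, hdist e.2 (hall₂ e he) (hd ▸ h₁)]
  refine ⟨by omega, hFlen, ?_, fun hv' => (hpos v hv').2 (by simp [dist, hext.root_new]),
    fun x hx => ?_⟩
  · rw [hF₂]
    exact (List.reverse_perm _).subperm.trans List.filter_sublist.subperm
  · obtain ⟨hx₁, hx₂⟩ := hpos x hx
    obtain ⟨⟨r, d⟩, hq⟩ := Option.ne_none_iff_exists'.1 hx₁
    have hdx : dist x = d := by simp [dist, hq]
    obtain ⟨d, rfl⟩ := Nat.exists_eq_succ_of_ne_zero (hdx ▸ hx₂)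
    obtain ⟨y, hxy, hy⟩ := hforest.succ x r d hq
    have hdy : dist y = d := by simp [dist, hy]
    -- The edge from `x` to its predecessor `y` is directed, so `x` has lost it.
    have hsplit : deg E x = deg (E.filter fun e => dist e.1 = dist e.2).reverse x
        + deg (E.filter fun e => !decide (dist e.1 = dist e.2)) x := by
      simp only [deg, List.countP_reverse]
      rw [List.countP_eq_countP_filter_add E _ fun e => decide (dist e.1 = dist e.2),
        List.countP_eq_countP_filter_add E (fun e => decide (e.2 = x))
          fun e => decide (dist e.1 = dist e.2)]
      omega
    have : 0 < deg (E.filter fun e => !decide (dist e.1 = dist e.2)) x := by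
      rw [deg_pos_iff, mem_verts]
      rcases hxy with hxy | hxy
      · exact ⟨(x, y), List.mem_filter.2 ⟨hxy, by simp [hdx, hdy]⟩, .inl rfl⟩
      · exact ⟨(y, x), List.mem_filter.2 ⟨hxy, by simp [hdx, hdy]⟩, .inr rfl⟩
    rw [hF₂]
    omega

/-! ### The sampler -/

theorem IsDecomposition.eq_nil {E : List (Fin n × Fin n)} {cs : List (List (Fin n × Fin n))}
    (h : IsDecomposition E cs) (hE : ∀ x, deg E x = 0) : cs = [] := by
  refine List.eq_nil_iff_forall_not_mem.2 fun C hC => ?_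
  obtain ⟨e, he⟩ := List.exists_mem_of_ne_nil C (h.ne_nil C hC)
  have h₁ := deg_pos_iff.2 (mem_verts.2 ⟨e, he, .inl rfl⟩)
  have h₂ := deg_le_of_subperm (h.subperm C hC) e.1
  rw [hE] at h₂
  omega

theorem length_le_sum_length {α : Type} {cs : List (List α)} (h : ∀ C ∈ cs, C ≠ []) :
    cs.length ≤ (cs.map List.length).sum := by
  induction cs with
  | nil => simp
  | cons C cs ih =>
    have h₁ := ih fun C hC => h C (by simp [hC])
    have h₂ := List.length_pos_iff.2 (h C (by simp))
    simp only [List.map_cons, List.sum_cons, List.length_cons]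
    omega

theorem sum_map_pow_le {α : Type} (f : α → ℕ) (l : List α) {j : ℕ} (hj : j ≠ 0) :
    (l.map fun a => f a ^ j).sum ≤ (l.map f).sum ^ j := by
  induction l with
  | nil => simp
  | cons a l ih =>
    simp only [List.map_cons, List.sum_cons]
    exact (Nat.add_le_add_left ih _).trans (pow_add_pow_le (Nat.zero_le _) (Nat.zero_le _) hj)

/-- The graph `E` is a legitimate argument of the sampler: it is connected, has no loops, and all
its degrees are at most `δ`. -/
structure IsPart (E : List (Fin n × Fin n)) (δ : ℕ) : Prop where
  loopless : ∀ e ∈ E, e.1 ≠ e.2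
  conn : Conn E
  deg_le : ∀ x, deg E x ≤ δ

/-- What the source `v` leaves undirected: parts with smaller degrees, without `v`. -/
structure IsResidue (E : List (Fin n × Fin n)) (δ : ℕ) (cs : List (List (Fin n × Fin n))) :
    Prop where
  part : ∀ C ∈ cs, IsPart C (δ - 1) ∧ C ≠ [] ∧ C.length < E.length
  nil : δ ≤ 1 → cs = []
  sum_length : (cs.map List.length).sum ≤ E.length
  sum_card : (cs.map fun C => (verts C).card).sum ≤ (verts E).card - 1

theorem IsPart.isResidue {E : List (Fin n × Fin n)} {δ : ℕ} (h : IsPart E δ) {v : Fin n}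
    (hv : v ∈ verts E) {F : List (Fin n × Fin n)} {cs : List (List (Fin n × Fin n))}
    (hFE : F.Subperm E) (hvF : v ∉ verts F) (hdeg : ∀ x ∈ verts F, deg F x < deg E x)
    (hcs : IsDecomposition F cs) : IsResidue E δ cs := by
  have hF : ∀ x, deg F x ≤ δ - 1 := fun x => by
    by_cases hx : x ∈ verts F
    · have := hdeg x hx
      have := h.deg_le x
      omega
    · have := mt deg_pos_iff.1 hx
      omega
  have hsub : verts F ⊆ (verts E).erase v := fun x hx =>
    Finset.mem_erase.2 ⟨fun hxv => hvF (hxv ▸ hx), verts_mono hFE.subset hx⟩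
  have hlen : F.length < E.length := by
    refine lt_of_le_of_ne hFE.length_le fun heq => hvF ?_
    obtain ⟨e, he, hev⟩ := mem_verts.1 hv
    exact mem_verts.2 ⟨e, (hFE.perm_of_length_le heq.ge).mem_iff.2 he, hev⟩
  refine ⟨fun C hC => ⟨⟨fun e he => h.loopless e (hFE.subset ((hcs.subperm C hC).subset he)),
    hcs.conn C hC, fun x => (deg_le_of_subperm (hcs.subperm C hC) x).trans (hF x)⟩,
    hcs.ne_nil C hC, (hcs.subperm C hC).length_le.trans_lt hlen⟩,
    fun hδ => hcs.eq_nil fun x => ?_, hcs.sum_length.trans hlen.le, hcs.sum_card.trans ?_⟩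
  · have := hF x
    omega
  · rw [← Finset.card_erase_of_mem hv]
    exact Finset.card_le_card hsub

theorem IsPart.one_le {E : List (Fin n × Fin n)} {δ : ℕ} (h : IsPart E δ) (hE : E ≠ []) :
    1 ≤ δ := by
  obtain ⟨e, he⟩ := List.exists_mem_of_ne_nil E hE
  exact (deg_pos_iff.2 (mem_verts.2 ⟨e, he, .inl rfl⟩)).trans_le (h.deg_le _)

theorem IsPart.two_mul_length_le_pow {E : List (Fin n × Fin n)} {δ : ℕ} (h : IsPart E δ)
    (hE : E ≠ []) : 2 * E.length ≤ (verts E).card ^ δ := by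
  obtain ⟨j, rfl⟩ := Nat.exists_eq_add_of_le' (h.one_le hE)
  have hj : j + 1 ≤ (verts E).card ^ j :=
    (Nat.lt_two_pow_self (n := j)).trans_le
      (Nat.pow_le_pow_left (two_le_card_verts hE h.loopless) j)
  calc 2 * E.length ≤ (j + 1) * (verts E).card := two_mul_length_le h.deg_le
    _ ≤ (verts E).card ^ j * (verts E).card := Nat.mul_le_mul_right _ hj
    _ = _ := (pow_succ _ _).symm

/-- The bound for the number of steps of `W` in a part with `p` vertices and degrees at most `δ`.
The work outside the recursive calls takes at most `73` steps per edge; a part with `δ ≤ 1` is a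
single edge. -/
def weightSteps (δ p : ℕ) : ℕ := if δ ≤ 1 then 73 else 146 * p ^ (δ - 1)

/-- The gap that pays for the linear work in the recursion for `W`, with `p = q + 2` vertices and
`δ = j + 3`. -/
theorem pow_gap (q j : ℕ) : (q + 1) ^ (j + 2) + (j + 2) * (q + 1) ≤ (q + 2) ^ (j + 2) := by
  induction j with
  | zero =>
    norm_num
    nlinarith
  | succ j ih =>
    have h : (j + 3) * (q + 1) ≤ (q + 2) * ((j + 2) * (q + 1)) := by
      rw [← mul_assoc]
      exact Nat.mul_le_mul_right _ (by nlinarith [Nat.zero_le (q * j)])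
    calc (q + 1) ^ (j + 2 + 1) + (j + 3) * (q + 1)
        ≤ (q + 2) * (q + 1) ^ (j + 2) + (q + 2) * ((j + 2) * (q + 1)) := by
          rw [pow_succ']
          exact Nat.add_le_add (Nat.mul_le_mul_right _ (by omega)) h
      _ ≤ (q + 2) * (q + 2) ^ (j + 2) := by
          rw [← mul_add]
          exact Nat.mul_le_mul_left _ ih
      _ = (q + 2) ^ (j + 2 + 1) := (pow_succ' _ _).symm

/-- The recursion for the step count of `W`. A recursive call for each vertex of the residue costs
`p - 1` times the bound for degrees at most `δ - 1`; the gap between `(p - 1) ^ (δ - 1)` and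
`p ^ (δ - 1)` pays for the linear work, with a constant that does not depend on `δ`. -/
theorem IsResidue.sum_weightSteps_le {E : List (Fin n × Fin n)} {δ : ℕ} (h : IsPart E δ)
    (hE : E ≠ []) {cs : List (List (Fin n × Fin n))} (hcs : IsResidue E δ cs) :
    73 * E.length
        + (cs.map fun C => (verts C).card * weightSteps (δ - 1) (verts C).card).sum
      ≤ weightSteps δ (verts E).card := by
  have hp := two_le_card_verts hE h.loopless
  have hm := two_mul_length_le h.deg_le
  have hone := h.one_le hE
  have hsum := hcs.sum_card
  rcases (by omega : δ = 1 ∨ δ = 2 ∨ 3 ≤ δ) with rfl | rfl | hδ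
  · have := h.conn.length_le_one h.deg_le
    simp [hcs.nil le_rfl, weightSteps]
    omega
  · simp only [weightSteps, Nat.add_one_sub_one, le_refl, if_true, List.sum_map_mul_right]
    simp only [Nat.reduceLeDiff, if_false, pow_one]
    omega
  · obtain ⟨j, rfl⟩ := Nat.exists_eq_add_of_le' hδ
    obtain ⟨q, hq⟩ := Nat.exists_eq_add_of_le' hp
    rw [hq] at hm hsum ⊢
    have h₁ : (cs.map fun C => (verts C).card * weightSteps (j + 2) (verts C).card).sum
        ≤ 146 * (q + 1) ^ (j + 2) := by
      have : ∀ p, p * weightSteps (j + 2) p = 146 * p ^ (j + 2) := fun p => by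
        rw [weightSteps, if_neg (by omega), show j + 2 - 1 = j + 1 from rfl]
        ring
      simp only [this, List.sum_map_mul_left]
      refine Nat.mul_le_mul_left _ ((sum_map_pow_le _ cs (by omega)).trans ?_)
      exact Nat.pow_le_pow_left (by omega) _
    have h₂ : (q + 1) ^ (j + 2) + (j + 2) * (q + 1) ≤ (q + 2) ^ (j + 2) := pow_gap q j
    have h₃ : (j + 3) * (q + 2) ≤ 4 * ((j + 2) * (q + 1)) := by
      nlinarith [Nat.zero_le (j * q)]
    rw [show j + 3 - 1 = j + 2 from rfl, weightSteps, if_neg (by omega : ¬ j + 3 ≤ 1),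
      show j + 3 - 1 = j + 2 from rfl]
    linarith

/-- The recursion depth is bounded by the number of edges. That weights are positive is needed for
the random choice of a source. -/
theorem ensures_W :
    ∀ (depth : ℕ) (E : List (Fin n × Fin n)) (δ : ℕ) (v : Fin n), E.length ≤ depth → IsPart E δ →
      v ∈ verts E →
      (W depth E v).Ensures fun w t => 0 < w ∧ t ≤ weightSteps δ (verts E).card := by
  intro depth
  induction depth with
  | zero =>
    intro E δ v hE _ hv
    rw [List.length_eq_zero_iff.1 (Nat.le_zero.1 hE)] at hv
    simp [verts] at hv
  | succ depth ih =>
    intro E δ v hdepth hE hv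
    have hne : E ≠ [] := by
      rintro rfl
      simp [verts] at hv
    have hpos := List.length_pos_iff.2 hne
    unfold W
    refine (ensures_flowed hE.loopless hE.conn hv).bind ?_
    rintro F t₁ ⟨ht₁, -, hFE, hvF, hdeg⟩
    refine (ensures_components F.2).bind ?_
    rintro cs t₂ ⟨ht₂, hcs⟩
    have hF := hFE.length_le
    have hres := hE.isResidue hv hFE hvF hdeg hcs
    refine (ensures_forEach_sum (fun _ p => 0 < p)
      (fun C => 17 * C.length - 1
        + (verts C).card * weightSteps (δ - 1) (verts C).card) ?_ one_pos).mono ?_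
    · intro C _ p hC hp
      obtain ⟨hpart, hCne, hlen⟩ := hres.part C hC
      refine (ensures_vertexList C).bind ?_
      rintro vs t₃ ⟨ht₃, hnodup, hvs⟩
      have hcard : vs.length = (verts C).card := by rw [← hvs, List.toFinset_card_of_nodup hnodup]
      -- Every weight is positive, so the sum is at least the number of vertices visited.
      refine (ensures_forEach_const (fun r s => vs.length ≤ r.length + s)
        (weightSteps (δ - 1) (verts C).card + 1) ?_ (by simp)).bind ?_
      · intro u r s hu hs
        refine (ih C (δ - 1) u (by omega) hpart (by rw [← hvs]; simpa using hu)).bind ?_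
        rintro w t₄ ⟨hw, ht₄⟩
        refine ensures_op ⟨?_, by omega⟩
        simp only [List.length_cons] at hs
        omega
      · rintro s t₄ ⟨hs, ht₄⟩
        have h₁ := two_le_card_verts hCne hpart.loopless
        have h₂ := card_verts_le C
        simp only [List.length_nil, zero_add] at hs
        refine ensures_op ⟨Nat.mul_pos hp (by omega), ?_⟩
        rw [hcard, mul_add, mul_add] at ht₄
        omega
    · rintro p t₃ ⟨hp, ht₃⟩
      refine ⟨hp, le_trans ?_ (hres.sum_weightSteps_le hE hne)⟩
      have : (cs.map fun C => 17 * C.length - 1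
          + (verts C).card * weightSteps (δ - 1) (verts C).card + 1).sum
          = 17 * (cs.map List.length).sum
            + (cs.map fun C => (verts C).card * weightSteps (δ - 1) (verts C).card).sum := by
        rw [← List.sum_map_mul_left, ← List.sum_map_add]
        refine congrArg List.sum (List.map_congr_left fun C hC => ?_)
        have := List.length_pos_iff.2 (hres.part C hC).2.1
        omega
      have := hres.sum_length
      omega

theorem ensures_locate : ∀ (ws : List (Fin n × ℕ)) (r : ℕ), r < (ws.map Prod.snd).sum →
    (locate ws r).Ensures fun v t => v ∈ ws.map Prod.fst ∧ t ≤ 2 * ws.length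
  | [], r, hr => by simp at hr
  | (v, w) :: ws, r, hr => by
    unfold locate
    refine ensures_op_bind ?_
    by_cases h : r < w
    · rw [if_pos (by simpa using h)]
      refine ensures_pure ⟨by simp, ?_⟩
      simp only [List.length_cons]
      omega
    · rw [if_neg (by simpa using h)]
      refine ensures_op_bind ((ensures_locate ws (r - w) ?_).mono ?_)
      · simp only [List.map_cons, List.sum_cons] at hr
        omega
      · rintro u t ⟨hu, ht⟩
        refine ⟨by simp [hu], ?_⟩
        simp only [List.length_cons]
        omega

theorem ensures_randomSource {depth : ℕ} {E : List (Fin n × Fin n)} {δ : ℕ}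
    (hdepth : E.length ≤ depth) (hE : IsPart E δ) (hne : E ≠ []) :
    (randomSource depth E).Ensures fun v t => v ∈ verts E ∧ t ≤ 162 * (verts E).card ^ δ := by
  have hp := two_le_card_verts hne hE.loopless
  unfold randomSource
  refine (ensures_vertexList E).bind ?_
  rintro vs t₁ ⟨ht₁, hnodup, hvs⟩
  have hcard : vs.length = (verts E).card := by rw [← hvs, List.toFinset_card_of_nodup hnodup]
  refine (ensures_forEach_const (fun r s => vs.length ≤ r.length + s.2 ∧
    r.length + s.1.length = vs.length ∧ (∀ u ∈ s.1.map Prod.fst, u ∈ verts E) ∧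
      s.2 = (s.1.map Prod.snd).sum) (weightSteps δ (verts E).card + 1) ?_ (by simp)).bind ?_
  · rintro v r ⟨ws, total⟩ hv ⟨h₁, h₂, h₃, h₄⟩
    have hv' : v ∈ verts E := by
      rw [← hvs]
      simpa using hv
    refine (ensures_W depth E δ v hdepth hE hv').bind ?_
    rintro w t ⟨hw, ht⟩
    simp only [List.length_cons] at h₁ h₂
    refine ensures_op ⟨⟨?_, ?_, fun u hu => ?_, ?_⟩, by omega⟩
    · dsimp only
      omega
    · simp only [List.length_cons]
      omega
    · rw [List.map_cons, List.mem_cons] at hu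
      rcases hu with rfl | hu
      exacts [hv', h₃ u hu]
    · simp only [List.map_cons, List.sum_cons]
      dsimp only at h₄
      omega
  · rintro ⟨ws, total⟩ t₂ ⟨⟨h₁, h₂, h₃, h₄⟩, ht₂⟩
    simp only [List.length_nil, zero_add] at h₁ h₂ h₃ h₄
    refine (ensures_randBelow (Q := fun r t => r < total ∧ t = 1) (by omega)
      fun r hr => ⟨hr, rfl⟩).bind ?_
    rintro r _ ⟨hr, rfl⟩
    refine (ensures_locate ws r (h₄ ▸ hr)).mono ?_
    rintro v t₃ ⟨hv, ht₃⟩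
    refine ⟨h₃ v hv, ?_⟩
    have hm := hE.two_mul_length_le_pow hne
    have hone := hE.one_le hne
    have hpp : (verts E).card ≤ (verts E).card ^ δ := Nat.le_self_pow (by omega) _
    have hw : (verts E).card * weightSteps δ (verts E).card ≤ 146 * (verts E).card ^ δ := by
      unfold weightSteps
      split_ifs with h
      · have : δ = 1 := by omega
        subst this
        omega
      · obtain ⟨j, rfl⟩ := Nat.exists_eq_add_of_le' hone
        rw [Nat.add_sub_cancel, pow_succ]
        exact le_of_eq (by ring)
    rw [hcard, mul_add, mul_add] at ht₂
    omega

/-- The recursive calls of `randEdge` on the residue cost at most half of the bound for the whole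
part, because the degrees have dropped and `p ≥ 2`. -/
theorem IsResidue.sum_pow_le {E : List (Fin n × Fin n)} {δ : ℕ} (h : IsPart E δ)
    (hE : E ≠ []) {cs : List (List (Fin n × Fin n))} (hcs : IsResidue E δ cs) :
    2 * (cs.map fun C => (verts C).card ^ (δ - 1)).sum ≤ (verts E).card ^ δ := by
  have hp := two_le_card_verts hE h.loopless
  by_cases hδ : δ ≤ 1
  · simp [hcs.nil hδ]
  · obtain ⟨j, rfl⟩ := Nat.exists_eq_add_of_le' (by omega : 1 ≤ δ)
    rw [Nat.add_sub_cancel, pow_succ']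
    refine Nat.mul_le_mul hp ((sum_map_pow_le _ cs (by omega)).trans ?_)
    exact Nat.pow_le_pow_left (hcs.sum_card.trans (Nat.sub_le _ _)) _

theorem ensures_randEdge :
    ∀ (depth : ℕ) (E A : List (Fin n × Fin n)) (δ : ℕ), E.length ≤ depth → IsPart E δ → E ≠ [] →
      (randEdge depth E A).Ensures fun A' t =>
        A'.length ≤ A.length + E.length ∧ t ≤ 400 * (verts E).card ^ δ := by
  intro depth
  induction depth with
  | zero => exact fun E A δ hE _ hne => absurd (List.length_eq_zero_iff.1 (Nat.le_zero.1 hE)) hne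
  | succ depth ih =>
    intro E A δ hdepth hE hne
    have hpos := List.length_pos_iff.2 hne
    unfold randEdge
    refine (ensures_randomSource hdepth hE hne).bind ?_
    rintro v t₀ ⟨hv, ht₀⟩
    refine (ensures_flowed hE.loopless hE.conn hv).bind ?_
    rintro F t₁ ⟨ht₁, hFlen, hFE, hvF, hdeg⟩
    refine (ensures_forEach_const (fun r A' => r.length + A'.length = F.1.length + A.length) 1
      (fun e r A' _ h => ensures_op ⟨?_, le_rfl⟩) rfl).bind ?_
    · simp only [List.length_cons] at h ⊢
      omega
    rintro A₁ t₂ ⟨hA₁, ht₂⟩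
    refine (ensures_components F.2).bind ?_
    rintro cs t₃ ⟨ht₃, hcs⟩
    have hF := hFE.length_le
    have hres := hE.isResidue hv hFE hvF hdeg hcs
    refine (ensures_forEach_sum
      (fun r A' => A'.length + (r.map List.length).sum ≤ A.length + E.length)
      (fun C => 400 * (verts C).card ^ (δ - 1)) ?_ ?_).mono ?_
    · intro C r A' hC hA'
      obtain ⟨hpart, hCne, hlen⟩ := hres.part C hC
      refine (ih C A' (δ - 1) (by omega) hpart hCne).mono ?_
      rintro A'' t ⟨hA'', ht⟩
      simp only [List.map_cons, List.sum_cons] at hA'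
      exact ⟨by omega, ht⟩
    · have := hcs.sum_length
      simp only [List.length_nil, zero_add] at hA₁
      omega
    · rintro A' t₄ ⟨hA', ht₄⟩
      simp only [List.map_nil, List.sum_nil, add_zero] at hA'
      refine ⟨hA', ?_⟩
      have h₁ := hres.sum_pow_le hE hne
      have h₂ := hE.two_mul_length_le_pow hne
      have h₃ := (length_le_sum_length hcs.ne_nil).trans hres.sum_length
      have h₄ : (cs.map fun C => 400 * (verts C).card ^ (δ - 1) + 1).sum
          = 400 * (cs.map fun C => (verts C).card ^ (δ - 1)).sum + cs.length := by
        rw [List.sum_map_add, List.sum_map_mul_left]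
        simp
      omega

theorem ensures_sampleDAG {M : EdgeLists n} {Δ : ℕ} (hloop : ∀ e ∈ M.und, e.1 ≠ e.2)
    (hdeg : ∀ x, deg M.und x ≤ Δ) :
    (sampleDAG M).Ensures fun G t => G.length ≤ M.dir.length + M.und.length ∧
      t ≤ 2 * M.dir.length + 25 * M.und.length + 10 + 400 * n ^ Δ := by
  unfold sampleDAG
  refine (ensures_forEach_const (fun r A' => r.length + A'.length = M.dir.length) 1
    (fun e r A' _ h => ensures_op ⟨?_, le_rfl⟩) rfl).bind ?_
  · simp only [List.length_cons] at h ⊢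
    omega
  rintro A t₁ ⟨hA, ht₁⟩
  refine (ensures_components M.und).bind ?_
  rintro cs t₂ ⟨ht₂, hcs⟩
  refine (ensures_forEach_sum
    (fun r A' => A'.length + (r.map List.length).sum ≤ M.dir.length + M.und.length)
    (fun C => 400 * (verts C).card ^ Δ) ?_ ?_).mono ?_
  · intro C r A' hC hA'
    have hsub := hcs.subperm C hC
    have hpart : IsPart C Δ := ⟨fun e he => hloop e (hsub.subset he), hcs.conn C hC,
      fun x => (deg_le_of_subperm hsub x).trans (hdeg x)⟩
    refine (ensures_randEdge _ C A' Δ hsub.length_le hpart (hcs.ne_nil C hC)).mono ?_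
    rintro A'' t ⟨hA'', ht⟩
    simp only [List.map_cons, List.sum_cons] at hA'
    exact ⟨by omega, ht⟩
  · have := hcs.sum_length
    simp only [List.length_nil, zero_add] at hA
    omega
  · rintro A' t₃ ⟨hA', ht₃⟩
    simp only [List.map_nil, List.sum_nil, add_zero] at hA'
    refine ⟨hA', ?_⟩
    have h₁ : (cs.map fun C => (verts C).card ^ Δ).sum ≤ n ^ Δ := by
      by_cases hΔ : Δ = 0
      · rw [hcs.eq_nil fun x => by have := hdeg x; omega]
        simp
      · refine (sum_map_pow_le _ cs hΔ).trans (Nat.pow_le_pow_left (hcs.sum_card.trans ?_) _)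
        simpa using Finset.card_le_univ (verts M.und)
    have h₃ := (length_le_sum_length hcs.ne_nil).trans hcs.sum_length
    have h₄ : (cs.map fun C => 400 * (verts C).card ^ Δ + 1).sum
        = 400 * (cs.map fun C => (verts C).card ^ Δ).sum + cs.length := by
      rw [List.sum_map_add, List.sum_map_mul_left]
      simp
    omega

/-! ### The Meek rules -/

theorem ensures_anyOf {α : Type} {l : List α} {test : α → Comp Bool} (Q : Prop) (c : ℕ)
    (h : ∀ a ∈ l, (test a).Ensures fun b t => (Q → b = false) ∧ t ≤ c) :
    (anyOf l test).Ensures fun b t => (Q → b = false) ∧ t ≤ l.length * (c + 2) + 1 := by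
  refine ensures_forEach_const (fun _ b => Q → b = false) (c + 1) (fun a _ b ha hb => ?_)
    fun _ => rfl
  refine (h a ha).bind ?_
  rintro b' t ⟨hb', ht⟩
  exact ensures_op ⟨fun hQ => by rw [hb hQ, hb' hQ]; rfl, by omega⟩

/-- No Meek rule applies to the edge between `a` and `b` if `b` is the only neighbour of `a`. -/
theorem ensures_meekForces {adj : Fin n → Fin n → Bool} {nbr : Fin n → List (Fin n)}
    {known : Fin n → Fin n → Bool} {a b : Fin n} {L : ℕ} (hL : (nbr a).length ≤ L)
    (hab : unknown known a b = true) :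
    (meekForces adj nbr known a b).Ensures fun r t =>
      ((∀ c ∈ nbr a, c = b) → r = false) ∧ t ≤ 25 * (L + 1) ^ 2 := by
  have hk : known a b = false := by
    simp only [unknown, Bool.and_eq_true, Bool.not_eq_true'] at hab
    exact hab.1
  unfold meekForces
  refine (ensures_anyOf (∀ c ∈ nbr a, c = b) 1 fun c hc =>
    ensures_op ⟨fun h => by simp [h c hc], le_rfl⟩).bind ?_
  rintro r₁ t₁ ⟨h₁, ht₁⟩
  refine (ensures_anyOf (∀ c ∈ nbr a, c = b) 1 fun c hc =>
    ensures_op ⟨fun h => by simp [h c hc, hk], le_rfl⟩).bind ?_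
  rintro r₂ t₂ ⟨h₂, ht₂⟩
  refine (ensures_anyOf (∀ c ∈ nbr a, c = b) _ fun c hc => ensures_anyOf _ 1 fun d hd =>
    ensures_op ⟨fun h => by simp [h c hc, h d hd], le_rfl⟩).bind ?_
  rintro r₃ t₃ ⟨h₃, ht₃⟩
  refine (ensures_anyOf (∀ c ∈ nbr a, c = b) _ fun d hd => ensures_anyOf _ 1 fun c hc =>
    ensures_op ⟨fun h => by simp [h d hd], le_rfl⟩).bind ?_
  rintro r₄ t₄ ⟨h₄, ht₄⟩
  refine ensures_op ⟨fun h => by rw [h₁ h, h₂ h, h₃ h, h₄ h]; rfl, ?_⟩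
  have : (nbr a).length * ((nbr a).length * (1 + 2) + 1 + 2) ≤ L * (L * (1 + 2) + 1 + 2) :=
    Nat.mul_le_mul hL (by omega)
  nlinarith

/-- If all edges of `E` are isolated from the other edges of the graph, then the first round
changes nothing and is the last one. -/
theorem ensures_meekRounds {adj : Fin n → Fin n → Bool} {nbr : Fin n → List (Fin n)}
    {E : List (Fin n × Fin n)} {L R : ℕ} (hL : ∀ x, (nbr x).length ≤ L)
    (hR : R = E.length * (50 * (L + 1) ^ 2 + 3) + 1) :
    ∀ (b : ℕ) (known : Fin n → Fin n → Bool),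
      (meekRounds adj nbr E b known).Ensures fun _ t => t ≤ b * R + 1 ∧
        ((∀ e ∈ E, (∀ c ∈ nbr e.1, c = e.2) ∧ ∀ c ∈ nbr e.2, c = e.1) → t ≤ R + 1) := by
  intro b
  induction b with
  | zero =>
    intro known
    unfold meekRounds
    exact ensures_op ⟨by omega, by omega⟩
  | succ b ih =>
    intro known
    unfold meekRounds
    refine (ensures_forEach_const (fun _ s =>
      (∀ e ∈ E, (∀ c ∈ nbr e.1, c = e.2) ∧ ∀ c ∈ nbr e.2, c = e.1) → s.2 = false)
      (50 * (L + 1) ^ 2 + 2) (fun e _ s he hs => ?_) fun _ => rfl).bind ?_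
    · refine ensures_op_bind ?_
      by_cases ho : unknown s.1 e.1 e.2 = true
      · rw [if_pos ho]
        refine (ensures_meekForces (hL e.1) ho).bind ?_
        rintro forth t₁ ⟨h₁, ht₁⟩
        cases forth with
        | true => exact ensures_op ⟨fun h => by simpa using h₁ (h e he).1, by omega⟩
        | false =>
          have ho' : unknown s.1 e.2 e.1 = true := by
            rw [← ho, unknown, unknown, Bool.and_comm]
          refine (ensures_meekForces (hL e.2) ho').bind ?_
          rintro back t₂ ⟨h₂, ht₂⟩
          cases back with
          | true => exact ensures_op ⟨fun h => by simpa using h₂ (h e he).2, by omega⟩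
          | false => exact ensures_pure ⟨hs, by omega⟩
      · rw [if_neg ho]
        exact ensures_pure ⟨hs, by omega⟩
    · rintro s t ⟨hs, ht⟩
      replace ht : t ≤ R := hR ▸ ht
      have hbR : (b + 1) * R = b * R + R := by ring
      by_cases h : s.2 = true
      · rw [if_pos h]
        refine (ih s.1).mono ?_
        rintro _ t' ⟨ht', -⟩
        exact ⟨by omega, fun hE => by simp [hs hE] at h⟩
      · rw [if_neg h]
        exact ensures_op ⟨by omega, fun _ => by omega⟩

/-! ### The estimator and the greedy algorithm -/

/-- What the running time analysis uses about the essential graph, given by its edge lists `M`: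
the degrees are bounded by `Δ` (in- and out-degree separately, for the directed edges), and for
`Δ ≤ 1` no vertex has two neighbours. -/
structure IsInput (M : EdgeLists n) (Δ : ℕ) : Prop where
  loopless : ∀ e ∈ M.und, e.1 ≠ e.2
  deg_und : ∀ x, deg M.und x ≤ Δ
  deg_dir : ∀ x, deg M.dir x ≤ 2 * Δ
  lt : Δ < n
  unique : Δ ≤ 1 → ∀ x y z, Joined M.und x y ∨ Joined M.dir x y →
    Joined M.und x z ∨ Joined M.dir x z → y = z

theorem mul_le_pow_self {Δ : ℕ} (h : Δ < n) : n * Δ ≤ n ^ Δ := by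
  rcases (by omega : Δ = 0 ∨ Δ = 1 ∨ 2 ≤ Δ) with rfl | rfl | h₂
  · simp
  · simp
  · calc n * Δ ≤ n * n := Nat.mul_le_mul_left _ h.le
      _ = n ^ 2 := (sq n).symm
      _ ≤ n ^ Δ := Nat.pow_le_pow_right (by omega) h₂

/-- The constant is `5 ^ 4`: up to `Δ = 5` it bounds the second factor, and from `Δ = 6` on the
left side is at most `n ^ 6`. -/
theorem sq_mul_pow_four_le {Δ : ℕ} (h : Δ < n) (h₂ : 2 ≤ Δ) : n ^ 2 * Δ ^ 4 ≤ 625 * n ^ Δ := by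
  rcases le_or_gt Δ 5 with h₅ | h₅
  · calc n ^ 2 * Δ ^ 4 ≤ n ^ Δ * 5 ^ 4 :=
          Nat.mul_le_mul (Nat.pow_le_pow_right (by omega) h₂) (Nat.pow_le_pow_left h₅ 4)
      _ = 625 * n ^ Δ := by ring
  · calc n ^ 2 * Δ ^ 4 ≤ n ^ 2 * n ^ 4 := Nat.mul_le_mul_left _ (Nat.pow_le_pow_left h.le 4)
      _ = n ^ 6 := by ring
      _ ≤ n ^ Δ := Nat.pow_le_pow_right (by omega) h₅
      _ ≤ 625 * n ^ Δ := by omega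

theorem IsInput.length_und_le {M : EdgeLists n} {Δ : ℕ} (h : IsInput M Δ) :
    M.und.length ≤ n * Δ := by
  have h₁ := two_mul_length_le h.deg_und
  have h₂ : (verts M.und).card ≤ n := by simpa using Finset.card_le_univ (verts M.und)
  nlinarith

theorem IsInput.length_dir_le {M : EdgeLists n} {Δ : ℕ} (h : IsInput M Δ) :
    M.dir.length ≤ n * Δ := by
  have h₁ := two_mul_length_le h.deg_dir
  have h₂ : (verts M.dir).card ≤ n := by simpa using Finset.card_le_univ (verts M.dir)
  nlinarith

theorem ensures_resolvedCount {M : EdgeLists n} {Δ : ℕ} (h : IsInput M Δ) (I : Fin n → Bool)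
    {G : List (Fin n × Fin n)} (hG : G.length ≤ M.dir.length + M.und.length) :
    (resolvedCount M I G).Ensures fun _ t => t ≤ 600000 * n ^ Δ := by
  have hu := h.length_und_le
  have hd := h.length_dir_le
  have hn := mul_le_pow_self h.lt
  have hpos : 0 < n ^ Δ := Nat.pow_pos (by have := h.lt; omega)
  unfold resolvedCount
  refine ensures_op_bind ((ensures_adjLists M.und _).bind ?_)
  rintro nbr₁ t₁ ⟨ht₁, hmem₁, hlen₁⟩
  refine (ensures_adjLists M.dir _).bind ?_
  rintro nbr t₂ ⟨ht₂, hmem, hlen⟩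
  refine ensures_op_bind ?_
  refine (ensures_forEach_const (fun _ _ => True) 1
    (fun e _ _ _ _ => ensures_op ⟨trivial, le_rfl⟩) trivial).bind ?_
  rintro adj₁ t₃ ⟨-, ht₃⟩
  refine (ensures_forEach_const (fun _ _ => True) 1
    (fun e _ _ _ _ => ensures_op ⟨trivial, le_rfl⟩) trivial).bind ?_
  rintro adj t₄ ⟨-, ht₄⟩
  refine ensures_op_bind ?_
  refine (ensures_forEach_const (fun _ _ => True) 1
    (fun e _ _ _ _ => ensures_op ⟨trivial, le_rfl⟩) trivial).bind ?_
  rintro known₁ t₅ ⟨-, ht₅⟩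
  refine (ensures_forEach_const (fun _ _ => True) 1 (fun e _ _ _ _ => ?_) trivial).bind ?_
  · split_ifs <;> exact ensures_op ⟨trivial, le_rfl⟩
  rintro known₂ t₆ ⟨-, ht₆⟩
  have hL : ∀ x, (nbr x).length ≤ 3 * Δ := fun x => by
    have := h.deg_und x
    have := h.deg_dir x
    rw [hlen, hlen₁, List.length_nil]
    omega
  refine (ensures_meekRounds hL rfl M.und.length known₂).bind ?_
  rintro known t₇ ⟨ht₇, hquiet⟩
  refine (ensures_forEach_const (fun _ _ => True) 1 (fun e _ _ _ _ => ?_) trivial).mono ?_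
  · split_ifs <;> exact ensures_op ⟨trivial, le_rfl⟩
  rintro count t₈ ⟨-, ht₈⟩
  have hmeek : t₇ ≤ 510000 * n ^ Δ := by
    by_cases hΔ : Δ ≤ 1
    · -- An undirected edge is the only edge at its ends, so no rule applies.
      have hone : ∀ x y, Joined M.und x y → ∀ c ∈ nbr x, c = y := fun x y hxy c hc =>
        h.unique hΔ x c y (by simpa [hmem, hmem₁] using hc) (.inl hxy)
      have hq := hquiet fun e he => ⟨hone e.1 e.2 (.inl he), hone e.2 e.1 (.inr he)⟩
      have : M.und.length * (50 * (3 * Δ + 1) ^ 2 + 3) ≤ M.und.length * 803 :=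
        Nat.mul_le_mul_left _ (by interval_cases Δ <;> norm_num)
      omega
    · have h₁ : 50 * (3 * Δ + 1) ^ 2 + 3 ≤ 803 * Δ ^ 2 := by nlinarith
      have h₂ : M.und.length * (M.und.length * (50 * (3 * Δ + 1) ^ 2 + 3))
          ≤ 501875 * n ^ Δ :=
        calc M.und.length * (M.und.length * (50 * (3 * Δ + 1) ^ 2 + 3))
            ≤ (n * Δ) * ((n * Δ) * (803 * Δ ^ 2)) :=
              Nat.mul_le_mul hu (Nat.mul_le_mul hu h₁)
          _ = 803 * (n ^ 2 * Δ ^ 4) := by ring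
          _ ≤ 803 * (625 * n ^ Δ) := Nat.mul_le_mul_left _ (sq_mul_pow_four_le h.lt (by omega))
          _ = 501875 * n ^ Δ := by ring
      rw [mul_add, mul_one] at ht₇
      omega
  omega

theorem ensures_estimate {M : EdgeLists n} {Δ : ℕ} (h : IsInput M Δ) (I : Fin n → Bool) {N : ℕ}
    (hN : 1 ≤ N) : (estimate M I N).Ensures fun _ t => t ≤ 600500 * (N * n ^ Δ) := by
  have hu := h.length_und_le
  have hd := h.length_dir_le
  have hn := mul_le_pow_self h.lt
  have hpos : 0 < n ^ Δ := Nat.pow_pos (by have := h.lt; omega)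
  unfold estimate
  refine (ensures_loop (fun j Gs => Gs.length + j = N ∧
    ∀ G ∈ Gs, G.length ≤ M.dir.length + M.und.length) (440 * n ^ Δ) N [] ?_ (by simp)).bind ?_
  · rintro j Gs hj ⟨hlen, hGs⟩
    refine (ensures_sampleDAG h.loopless h.deg_und).bind ?_
    rintro G t ⟨hG, ht⟩
    refine ensures_op ⟨⟨?_, fun G' hG' => ?_⟩, by omega⟩
    · simp only [List.length_cons]
      omega
    · rcases List.mem_cons.1 hG' with rfl | hG'
      exacts [hG, hGs G' hG']
  rintro Gs t₁ ⟨⟨hlen, hGs⟩, ht₁⟩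
  rw [add_zero] at hlen
  refine (ensures_forEach_const (fun _ _ => True) (600000 * n ^ Δ + 1)
    (fun G _ s hG _ => ?_) trivial).bind ?_
  · refine (ensures_resolvedCount h I (hGs G hG)).bind fun d t ht => ensures_op ⟨trivial, ?_⟩
    omega
  rintro s t₂ ⟨-, ht₂⟩
  refine ensures_op ?_
  rw [hlen] at ht₂
  nlinarith [Nat.mul_le_mul hN hpos, Nat.mul_le_mul_left N hpos]

theorem ensures_bestVertex {M : EdgeLists n} {Δ : ℕ} (h : IsInput M Δ) {N : ℕ} (hN : 1 ≤ N)
    (I : Fin n → Bool) (hI : ∃ v, I v = false) :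
    (bestVertex M N I).Ensures fun best t =>
      (∃ v g, best = some (v, g) ∧ I v = false) ∧ t ≤ 1201010 * (n * (N * n ^ Δ)) := by
  have hn := h.lt
  have hpos : 0 < N * n ^ Δ := Nat.mul_pos hN (Nat.pow_pos (by omega))
  refine (ensures_forEach_const (fun r best => (∀ v g, best = some (v, g) → I v = false) ∧
    (best = none → ∀ v, v ∈ r ∨ I v = true)) (1201000 * (N * n ^ Δ) + 3) ?_ (by simp)).mono ?_
  · rintro v r best - ⟨h₁, h₂⟩
    refine ensures_op_bind ?_
    cases hv : I v with
    | true =>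
      refine ensures_pure ⟨⟨h₁, fun hb w => ?_⟩, by omega⟩
      rcases h₂ hb w with hw | hw
      · rcases List.mem_cons.1 hw with rfl | hw
        exacts [.inr hv, .inl hw]
      · exact .inr hw
    | false =>
      refine ensures_op_bind ((ensures_estimate h (Function.update I v true) hN).bind ?_)
      intro x t₁ ht₁
      refine (ensures_estimate h I hN).bind ?_
      intro y t₂ ht₂
      have hnew : ∀ g : ℚ, (∀ w g', some (v, g) = some (w, g') → I w = false) := by
        rintro g w g' hw
        obtain ⟨rfl, -⟩ : v = w ∧ g = g' := by simpa using hw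
        exact hv
      match best with
      | none => exact ensures_op ⟨⟨hnew _, by simp⟩, by omega⟩
      | some (u, g) =>
        dsimp only
        split_ifs
        · exact ensures_op ⟨⟨hnew _, by simp⟩, by omega⟩
        · exact ensures_op ⟨⟨h₁, by simp⟩, by omega⟩
  · rintro best t ⟨⟨h₁, h₂⟩, ht⟩
    refine ⟨?_, ?_⟩
    · match best with
      | none =>
        obtain ⟨v, hv⟩ := hI
        simpa [hv] using h₂ rfl v
      | some (v, g) => exact ⟨v, g, rfl, h₁ v g rfl⟩
    · rw [List.length_finRange] at ht
      nlinarith [Nat.mul_le_mul_left n hpos]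

theorem ensures_generalGreedy {M : EdgeLists n} {Δ : ℕ} (h : IsInput M Δ) {k N : ℕ} (hk : 1 ≤ k)
    (hkn : k ≤ n) (hN : 1 ≤ N) :
    (generalGreedy M k N).Ensures fun _ t => t ≤ 1201020 * (k * N * n ^ (Δ + 1)) := by
  have hn := h.lt
  have hpos : 0 < n * (N * n ^ Δ) :=
    Nat.mul_pos (by omega) (Nat.mul_pos hN (Nat.pow_pos (by omega)))
  unfold generalGreedy
  refine ensures_op_bind ((ensures_loop
    (fun j I => (Finset.univ.filter fun v => I v = true).card + j = k)
    (1201010 * (n * (N * n ^ Δ)) + 1) k _ ?_ (by simp)).mono ?_)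
  · intro j I hj hI
    -- With `j + 1` iterations to come, fewer than `k ≤ n` vertices have been chosen.
    have hex : ∃ v, I v = false := by
      by_contra hall
      have : (Finset.univ.filter fun v => I v = true) = Finset.univ := by
        refine Finset.filter_true_of_mem fun v _ => ?_
        by_contra hv
        exact hall ⟨v, by simpa using hv⟩
      rw [this, Finset.card_univ, Fintype.card_fin] at hI
      omega
    refine (ensures_bestVertex h hN I hex).bind ?_
    rintro _ t ⟨⟨v, g, rfl, hv⟩, ht⟩
    refine ensures_op ⟨?_, by omega⟩
    have : (Finset.univ.filter fun w => Function.update I v true w = true)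
        = insert v (Finset.univ.filter fun w => I w = true) := by
      ext w
      by_cases hw : w = v
      · simp [hw]
      · simp [hw]
    rw [this, Finset.card_insert_of_notMem (by simp [hv])]
    omega
  · rintro I t ⟨-, ht⟩
    have h₁ : k * N * n ^ (Δ + 1) = k * (n * (N * n ^ Δ)) := by ring
    rw [h₁]
    nlinarith [Nat.mul_le_mul_left k hpos, Nat.mul_le_mul hk hpos]

/-! ### The essential graph as an input -/

theorem mem_markovClass_self {G : Digraph (Fin n)} (hG : IsDAG G) : G ∈ markovClass G :=
  ⟨hG, fun _ _ _ _ _ _ => Iff.rfl⟩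

theorem essentialGraph_und_irrefl (G : Digraph (Fin n)) (v : Fin n) :
    ¬ (essentialGraph G).und v v := by
  rintro ⟨⟨G₁, hG₁, h⟩, -⟩
  exact hG₁.1 v (.single h)

theorem essentialGraph_dir_irrefl {G : Digraph (Fin n)} (hG : IsDAG G) (v : Fin n) :
    ¬ (essentialGraph G).dir v v := fun h =>
  hG v (.single (h G (mem_markovClass_self hG)))

theorem mem_product_finRange (e : Fin n × Fin n) :
    e ∈ (List.finRange n).product (List.finRange n) :=
  List.mem_product.2 ⟨List.mem_finRange _, List.mem_finRange _⟩

theorem MixedGraph.mem_edgeLists_und {M : MixedGraph n} {e : Fin n × Fin n} :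
    e ∈ M.edgeLists.und ↔ e.1 < e.2 ∧ M.und e.1 e.2 := by
  simp [MixedGraph.edgeLists, mem_product_finRange]

theorem MixedGraph.mem_edgeLists_dir {M : MixedGraph n} {e : Fin n × Fin n} :
    e ∈ M.edgeLists.dir ↔ M.dir e.1 e.2 := by
  simp [MixedGraph.edgeLists, mem_product_finRange]

theorem MixedGraph.nodup_edgeLists (M : MixedGraph n) :
    M.edgeLists.und.Nodup ∧ M.edgeLists.dir.Nodup :=
  ⟨((List.nodup_finRange n).product (List.nodup_finRange n)).filter _,
    ((List.nodup_finRange n).product (List.nodup_finRange n)).filter _⟩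

/-- In a duplicate-free list, the pairs that agree under `f` with `x` are counted by their values
under `g`, if the pair is determined by both values. -/
theorem countP_le_card {l : List (Fin n × Fin n)} (hl : l.Nodup) (f g : Fin n × Fin n → Fin n)
    (hfg : ∀ e e', f e = f e' → g e = g e' → e = e') {x : Fin n} {s : Finset (Fin n)}
    (hs : ∀ e ∈ l, f e = x → g e ∈ s) : l.countP (fun e => f e = x) ≤ s.card := by
  rw [List.countP_eq_length_filter, ← List.toFinset_card_of_nodup (hl.filter _)]
  refine Finset.card_le_card_of_injOn g (fun e he => ?_) fun e he e' he' h => ?_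
  · have := List.mem_filter.1 (List.mem_toFinset.1 he)
    exact hs e this.1 (by simpa using this.2)
  · have h₁ := (List.mem_filter.1 (List.mem_toFinset.1 he)).2
    have h₂ := (List.mem_filter.1 (List.mem_toFinset.1 he')).2
    simp only [decide_eq_true_eq] at h₁ h₂
    exact hfg e e' (h₁.trans h₂.symm) h

open Classical in
theorem isInput_essentialGraph {G : Digraph (Fin n)} (hG : IsDAG G) (hn : 1 ≤ n) :
    IsInput (essentialGraph G).edgeLists (essentialGraph G).maxDegree := by
  set M := essentialGraph G
  let nbrs : Fin n → Finset (Fin n) := fun v =>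
    Finset.univ.filter fun w => M.und v w ∨ M.dir v w ∨ M.dir w v
  have hnbrs : ∀ v, (nbrs v).card ≤ M.maxDegree := fun v =>
    Finset.le_sup (f := M.degree) (Finset.mem_univ v)
  have hfst : ∀ e e' : Fin n × Fin n, e.1 = e'.1 → e.2 = e'.2 → e = e' := fun _ _ => Prod.ext
  have hsnd : ∀ e e' : Fin n × Fin n, e.2 = e'.2 → e.1 = e'.1 → e = e' := fun _ _ h₁ h₂ =>
    Prod.ext h₂ h₁
  refine ⟨fun e he => (MixedGraph.mem_edgeLists_und.1 he).1.ne, fun x => ?_, fun x => ?_, ?_,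
    fun hΔ x y z hy hz => ?_⟩
  · -- An edge at `x` is listed with `x` as first end if the other end is larger, and with `x` as
    -- second end if it is smaller.
    have h₁ := countP_le_card M.nodup_edgeLists.1 Prod.fst Prod.snd hfst (x := x)
      (s := (nbrs x).filter fun w => x < w) (by
        rintro ⟨a, b⟩ he rfl
        obtain ⟨hlt, he⟩ := MixedGraph.mem_edgeLists_und.1 he
        exact Finset.mem_filter.2 ⟨Finset.mem_filter.2 ⟨Finset.mem_univ _, .inl he⟩, hlt⟩)
    have h₂ := countP_le_card M.nodup_edgeLists.1 Prod.snd Prod.fst hsnd (x := x)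
      (s := (nbrs x).filter fun w => ¬ x < w) (by
        rintro ⟨a, b⟩ he rfl
        obtain ⟨hlt, he⟩ := MixedGraph.mem_edgeLists_und.1 he
        exact Finset.mem_filter.2
          ⟨Finset.mem_filter.2 ⟨Finset.mem_univ _, .inl (M.und_symm _ _ he)⟩, hlt.not_gt⟩)
    have h₃ := Finset.card_filter_add_card_filter_not (s := nbrs x) fun w => x < w
    have := hnbrs x
    unfold deg
    omega
  · have h₁ := countP_le_card M.nodup_edgeLists.2 Prod.fst Prod.snd hfst (x := x)
      (s := nbrs x) (by
        rintro ⟨a, b⟩ he rfl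
        exact Finset.mem_filter.2
          ⟨Finset.mem_univ _, .inr (.inl (MixedGraph.mem_edgeLists_dir.1 he))⟩)
    have h₂ := countP_le_card M.nodup_edgeLists.2 Prod.snd Prod.fst hsnd (x := x)
      (s := nbrs x) (by
        rintro ⟨a, b⟩ he rfl
        exact Finset.mem_filter.2
          ⟨Finset.mem_univ _, .inr (.inr (MixedGraph.mem_edgeLists_dir.1 he))⟩)
    have := hnbrs x
    unfold deg
    omega
  · refine (Finset.sup_lt_iff (show ⊥ < n from hn)).2 fun v _ => ?_
    have : (nbrs v).card < Fintype.card (Fin n) := by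
      refine Finset.card_lt_univ_of_notMem (x := v) fun hv => ?_
      rcases (Finset.mem_filter.1 hv).2 with h | h | h
      · exact essentialGraph_und_irrefl G v h
      · exact essentialGraph_dir_irrefl hG v h
      · exact essentialGraph_dir_irrefl hG v h
    rw [Fintype.card_fin] at this
    exact this
  · have hmem : ∀ w, Joined M.edgeLists.und x w ∨ Joined M.edgeLists.dir x w → w ∈ nbrs x := by
      rintro w ((h | h) | (h | h)) <;> refine Finset.mem_filter.2 ⟨Finset.mem_univ _, ?_⟩
      · exact .inl (MixedGraph.mem_edgeLists_und.1 h).2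
      · exact .inl (M.und_symm _ _ (MixedGraph.mem_edgeLists_und.1 h).2)
      · exact .inr (.inl (MixedGraph.mem_edgeLists_dir.1 h))
      · exact .inr (.inr (MixedGraph.mem_edgeLists_dir.1 h))
    exact Finset.card_le_one.1 ((hnbrs x).trans hΔ) y (hmem y hy) z (hmem z hz)

end GreedyDesign

theorem theorem4 :
    ∃ C : ℕ, ∀ (n : ℕ) (G : Digraph (Fin n)), GreedyDesign.IsDAG G →
      ∀ k N : ℕ, 1 ≤ k → k ≤ n → 1 ≤ N →
        (GreedyDesign.generalGreedy (GreedyDesign.essentialGraph G).edgeLists k N).RunsInTime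
          (C * (k * N * n ^ ((GreedyDesign.essentialGraph G).maxDegree + 1))) := by
  refine ⟨1201020, fun n G hG k N hk hkn hN => ?_⟩
  exact (GreedyDesign.ensures_generalGreedy
    (GreedyDesign.isInput_essentialGraph hG (hk.trans hkn)) hk hkn hN).runsInTime fun _ _ h => h
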